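/- Let $G$ be a finite simple directed acyclic graph with vertex set $V$, and for each vertex $i$ let $\mathrm{pa}(i)$ be a chosen word over $V$ that lists the parents of $i$ without repetition. A word over $V$ is \emph{singular} if no letter occurs twice in it. Let $\mathbf{Cau}(G)$ be the free strict Markov category whose objects are the words over $V$ (with concatenation as monoidal product and the empty word as unit), generated by duplicates $\delta_i : i \to ii$, discards $\epsilon_i : i \to \emptyset$ and one morphism (causal mechanism) $\kappa_i : \mathrm{pa}(i) \to i$ for each $i \in V$. For singular words $t$ and $v$, let $G_{t\to v}$ be the subgraph of $G$ consisting of the vertices in $t$ and $v$ and of all directed paths that end in $v$ and do not pass through or end in $t$ (starting in $t$ is allowed). The \emph{causal effect} $[v\|t] : t \to v$ is the morphism of $\mathbf{Cau}(G)$ represented by the string diagram that contains one node $\kappa_i$ for each vertex $i \notin t$ of $G_{t\to v}$, whose input wires are $t$, whose output wires are $v$, and in which the wire of each vertex $j$ of $G_{t\to v}$ (the output of $\kappa_j$, or the input wire $j$ if $j \in t$) is duplicated, or discarded, so as to give one copy to $\kappa_i$ for each child $i$ of $j$ in $G_{t\to v}$, and one output copy if $j \in v$. For distinct vertices $i,j$,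 a \emph{forward trek} from $i$ to $j$ is a directed path from $i$ to $j$; a \emph{backward trek} from $i$ to $j$ is a directed path from $j$ to $i$, or a pair of directed paths $k \to\dots\to i$ and $k\to\dots\to j$ with $k \neq i,j$ that have only the vertex $k$ in common. A trek from $i \in X$ to $j\in Y$ is a \emph{proper} trek from $X$ to $Y$ if it contains no vertex of $X \cup Y$ other than $i$ and $j$. The set $X$ is \emph{forward-} (\emph{backward-}) $t$\emph{-separated} from $Y$ by $Z$ if every proper forward (backward) trek from $X$ to $Y$ contains a vertex of $Z$; $X$ and $Y$ are $t$\emph{-separated} by $Z$ if $X$ is both forward- and backward-$t$-separated from $Y$ by $Z$. A word is identified here with its set of letters. In a Markov category $\mathbf M$ (coherence isomorphisms are suppressed), let $f : Z \to X \otimes Y$, with marginals $f_X = (1_X \otimes \epsilon_Y)\circ f$ and $f_Y = (\epsilon_X\otimes 1_Y)\circ f$. The objects $X$, $Y$ are \emph{conditionally independent given} $Z$ \emph{over} $f$ if $f = (f_X \otimes f_Y)\circ \delta_Z$. A morphism $g : X \otimes Z \to Y$ is a \emph{conditional} of $f$ (over $X$) if $f = (1_X \otimes g)\circ((\delta_X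 \circ f_X) \otimes 1_Z)\circ\delta_Z$. For $g : X \otimes Z \to Y$, $X$ is \emph{conditionally irrelevant to} $Y$ \emph{given} $Z$ \emph{over} $g$ if $g = \epsilon_X \otimes h$ for some $h : Z \to Y$. Let $\mathbf M$ be a Markov category, $F : \mathbf{Cau}(G) \to \mathbf M$ a strong Markov functor (a strong symmetric monoidal functor that preserves duplicates and discards), and $u$, $v$, $w$ pairwise disjoint singular words. Regard $F([vw\|u])$ as a morphism $F(u) \to F(v)\otimes F(w)$ through $F(vw)\cong F(v)\otimes F(w)$, and $F([w\|uv])$ as a morphism $F(v)\otimes F(u) \to F(w)$ through $F(v)\otimes F(u)\cong F(u)\otimes F(v) \cong F(uv)$. Then: 1. If $v$ and $w$ are $t$-separated by $u$ in $G$, then $F(v)$ and $F(w)$ are conditionally independent given $F(u)$ over $F([vw\|u])$. 2. If $v$ is backward-$t$-separated from $w$ by $u$ in $G$, then $F([w\|uv])$ is a conditional of $F([vw\|u])$ over $F(v)$; moreover $$F([vw\|u]) = (1_{F(v)}\otimes F([w\|uv]))\circ\big((\delta_{F(v)}\circ F([v\|u]))\otimes 1_{F(u)}\big)\circ\delta_{F(u)}.$$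 3. If $v$ is forward-$t$-separated from $w$ by $u$ in $G$, then $F(v)$ is conditionally irrelevant to $F(w)$ given $F(u)$ over $F([w\|uv])$; moreover $$F([w\|uv]) = \epsilon_{F(v)}\otimes F([w\|u]).$$ -/

import Mathlib

open CategoryTheory MonoidalCategory ComonObj

universe u

/-! ## Conditionals, independence and irrelevance in a Markov category -/

namespace MarkovNotions

variable {C : Type*} [Category C] [MonoidalCategory C] [MarkovCategory C]

/-- The marginal `Z ⟶ X` of `f : Z ⟶ X ⊗ Y` over `Y`: the output `Y` is discarded. -/
def marginalFst {X Y Z : C} (f : Z ⟶ X ⊗ Y) : Z ⟶ X := f ≫ X ◁ ε[Y] ≫ (ρ_ X).hom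

/-- The marginal `Z ⟶ Y` of `f : Z ⟶ X ⊗ Y` over `X`: the output `X` is discarded. -/
def marginalSnd {X Y Z : C} (f : Z ⟶ X ⊗ Y) : Z ⟶ Y := f ≫ ε[X] ▷ Y ≫ (λ_ Y).hom

/-- The composite `Z ⟶ X ⊗ Y` that duplicates its input, feeds one copy to `h : Z ⟶ X`,
duplicates the resulting output, and feeds one copy of it and the second copy of the input
to `g : X ⊗ Z ⟶ Y`. -/
def disintegrate {X Y Z : C} (h : Z ⟶ X) (g : X ⊗ Z ⟶ Y) : Z ⟶ X ⊗ Y :=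
  Δ[Z] ≫ (h ≫ Δ[X]) ▷ Z ≫ (α_ X X Z).hom ≫ X ◁ g

/-- `g` is a conditional of `f` over `X`. -/
def IsConditional {X Y Z : C} (f : Z ⟶ X ⊗ Y) (g : X ⊗ Z ⟶ Y) : Prop :=
  f = disintegrate (marginalFst f) g

/-- `X` and `Y` are conditionally independent given `Z` over `f`. -/
def CondIndep {X Y Z : C} (f : Z ⟶ X ⊗ Y) : Prop :=
  f = Δ[Z] ≫ (marginalFst f ⊗ₘ marginalSnd f)

/-- The morphism `X ⊗ Z ⟶ Y` that discards `X` and applies `g` to `Z`. -/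
def ignoreFst (X : C) {Y Z : C} (g : Z ⟶ Y) : X ⊗ Z ⟶ Y := ε[X] ▷ Z ≫ (λ_ Z).hom ≫ g

/-- `X` is conditionally irrelevant to `Y` given `Z` over `f`. -/
def CondIrrelevant {X Y Z : C} (f : X ⊗ Z ⟶ Y) : Prop := ∃ g : Z ⟶ Y, f = ignoreFst X g

/-- A strong Markov functor: a strong symmetric monoidal functor (the instance `F.Braided`)
that preserves the duplicates and the discards. -/
class IsMarkovFunctor {D : Type*} [Category D] [MonoidalCategory D] [MarkovCategory D]
    (F : C ⥤ D) [F.Braided] : Prop where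
  map_copy (X : C) : F.map Δ[X] ≫ Functor.OplaxMonoidal.δ F X X = Δ[F.obj X]
  map_discard (X : C) : F.map ε[X] ≫ Functor.OplaxMonoidal.η F = ε[F.obj X]

end MarkovNotions

/-! ## Causal graphs -/

/-- A directed acyclic graph on `V`, together with a chosen singular word `pa j`
(a list without repetition) that lists the parents of `j`, for every vertex `j`. -/
structure CausalGraph (V : Type u) extends Digraph V where
  acyclic : ∀ i, ¬ Relation.TransGen Adj i i
  pa : V → List V
  pa_nodup : ∀ j, (pa j).Nodup
  mem_pa : ∀ i j, i ∈ pa j ↔ Adj i j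

namespace CausalGraph

variable {V : Type u} (G : CausalGraph V)

/-- `p` is the list of vertices of a directed path from `i` to `j`; the trivial path is
included. Acyclicity makes the vertices of `p` distinct. -/
def IsDirectedPath (i j : V) (p : List V) : Prop :=
  p.IsChain G.Adj ∧ p.head? = some i ∧ p.getLast? = some j

/-! ### Treks and separation -/

/-- `T` is the vertex set of a forward trek from `i` to `j`. -/
def IsForwardTrek (i j : V) (T : Set V) : Prop :=
  i ≠ j ∧ ∃ p, G.IsDirectedPath i j p ∧ T = {x | x ∈ p}

/-- `T` is the vertex set of a backward trek from `i` to `j`: a directed path from `j` to `i`,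
or two directed paths from a third vertex `k` to `i` and to `j` that share only `k`. -/
def IsBackwardTrek (i j : V) (T : Set V) : Prop :=
  i ≠ j ∧
    ((∃ p, G.IsDirectedPath j i p ∧ T = {x | x ∈ p}) ∨
      ∃ k p q, k ≠ i ∧ k ≠ j ∧ G.IsDirectedPath k i p ∧ G.IsDirectedPath k j q ∧
        (∀ x, x ∈ p → x ∈ q → x = k) ∧ T = {x | x ∈ p ∨ x ∈ q})

/-- A trek from `i` to `j` with vertex set `T` is proper, as a trek from `X` to `Y`. -/
def IsProperTrek (X Y : Set V) (i j : V) (T : Set V) : Prop :=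
  i ∈ X ∧ j ∈ Y ∧ ∀ x ∈ T, x ∈ X ∨ x ∈ Y → x = i ∨ x = j

/-- `X` is forward-t-separated from `Y` by `Z`. -/
def ForwardTSeparated (X Y Z : Set V) : Prop :=
  ∀ i j T, G.IsForwardTrek i j T → IsProperTrek X Y i j T → ∃ k ∈ Z, k ∈ T

/-- `X` is backward-t-separated from `Y` by `Z`. -/
def BackwardTSeparated (X Y Z : Set V) : Prop :=
  ∀ i j T, G.IsBackwardTrek i j T → IsProperTrek X Y i j T → ∃ k ∈ Z, k ∈ T

/-- `X` and `Y` are t-separated by `Z`. -/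
def TSeparated (X Y Z : Set V) : Prop :=
  G.ForwardTSeparated X Y Z ∧ G.BackwardTSeparated X Y Z

/-! ### The free Markov category on the causal mechanisms -/

/-- Formal morphisms between words, built from identities, symmetries, duplicates, discards and
the causal mechanisms by composition and monoidal product. Duplicates and discards are provided
on all words; the relations `copy_append` and `discard_append` below reduce them to those on
single letters. -/
inductive Term : List V → List V → Type u
  | id (A : List V) : Term A A
  | comp {A B C : List V} : Term A B → Term B C → Term A C
  | tensor {A B C D : List V} : Term A B → Term C D → Term (A ++ C) (B ++ D)
  | swap (A B : List V) : Term (A ++ B) (B ++ A)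
  | copy (A : List V) : Term A (A ++ A)
  | discard (A : List V) : Term A []
  | mechanism (i : V) : Term (G.pa i) [i]

/-- The identity between two equal words. -/
def Term.ofEq {A B : List V} (h : A = B) : G.Term A B := h ▸ Term.id A

open Term in
/-- The smallest congruence on formal morphisms for which the axioms of a strict Markov category
hold; `Term.ofEq` only mediates between words that are equal, but not by definition. -/
inductive Rel : {A B : List V} → G.Term A B → G.Term A B → Prop
  | refl {A B} (f : G.Term A B) : Rel f f
  | symm {A B} {f g : G.Term A B} : Rel f g → Rel g f
  | trans {A B} {f g h : G.Term A B} : Rel f g → Rel g h → Rel f h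
  | comp_congr {A B C} {f f' : G.Term A B} {g g' : G.Term B C} :
      Rel f f' → Rel g g' → Rel (comp f g) (comp f' g')
  | tensor_congr {A B C D} {f f' : G.Term A B} {g g' : G.Term C D} :
      Rel f f' → Rel g g' → Rel (tensor f g) (tensor f' g')
  -- category
  | id_comp {A B} (f : G.Term A B) : Rel (comp (id A) f) f
  | comp_id {A B} (f : G.Term A B) : Rel (comp f (id B)) f
  | assoc {A B C D} (f : G.Term A B) (g : G.Term B C) (h : G.Term C D) :
      Rel (comp (comp f g) h) (comp f (comp g h))
  -- strict monoidal structure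
  | tensor_id (A B : List V) : Rel (tensor (id A) (id B)) (id (A ++ B))
  | tensor_comp {A B C A' B' C'} (f : G.Term A B) (g : G.Term B C)
      (f' : G.Term A' B') (g' : G.Term B' C') :
      Rel (tensor (comp f g) (comp f' g')) (comp (tensor f f') (tensor g g'))
  | tensor_assoc {A B A' B' A'' B''} (f : G.Term A B) (g : G.Term A' B') (h : G.Term A'' B'') :
      Rel (comp (tensor (tensor f g) h) (ofEq G (List.append_assoc B B' B'')))
        (comp (ofEq G (List.append_assoc A A' A'')) (tensor f (tensor g h)))
  | id_tensor {A B} (f : G.Term A B) : Rel (A := A) (B := B) (tensor (id []) f) f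
  | tensor_id_nil {A B} (f : G.Term A B) :
      Rel (comp (tensor f (id [])) (ofEq G (List.append_nil B)))
        (comp (ofEq G (List.append_nil A)) f)
  -- symmetry
  | swap_natural {A B C D} (f : G.Term A B) (g : G.Term C D) :
      Rel (comp (tensor f g) (swap B D)) (comp (swap A C) (tensor g f))
  | swap_swap (A B : List V) : Rel (comp (swap A B) (swap B A)) (id (A ++ B))
  | hexagon (A B C : List V) :
      Rel (comp (ofEq G (List.append_assoc A B C))
          (comp (swap A (B ++ C)) (ofEq G (List.append_assoc B C A))))
        (comp (tensor (swap A B) (id C))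
          (comp (ofEq G (List.append_assoc B A C)) (tensor (id B) (swap A C))))
  -- cocommutative comonoids
  | copy_assoc (A : List V) :
      Rel (comp (comp (copy A) (tensor (copy A) (id A))) (ofEq G (List.append_assoc A A A)))
        (comp (copy A) (tensor (id A) (copy A)))
  | copy_discard_left (A : List V) :
      Rel (A := A) (B := A) (comp (copy A) (tensor (discard A) (id A))) (id A)
  | copy_discard_right (A : List V) :
      Rel (comp (comp (copy A) (tensor (id A) (discard A))) (ofEq G (List.append_nil A))) (id A)
  | copy_swap (A : List V) : Rel (comp (copy A) (swap A A)) (copy A)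
  -- compatibility with the monoidal product
  | copy_append (A B : List V) :
      Rel (copy (A ++ B))
        (comp (tensor (copy A) (copy B))
          (comp (ofEq G (show (A ++ A) ++ (B ++ B) = A ++ ((A ++ B) ++ B) by simp))
            (comp (tensor (id A) (tensor (swap A B) (id B)))
              (ofEq G (show A ++ ((B ++ A) ++ B) = (A ++ B) ++ (A ++ B) by simp)))))
  | discard_append (A B : List V) :
      Rel (A := A ++ B) (B := []) (discard (A ++ B)) (tensor (discard A) (discard B))
  -- naturality of the discards
  | discard_natural {A B} (f : G.Term A B) : Rel (comp f (discard B)) (discard A)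

/-- Formal morphisms up to the congruence. -/
instance termSetoid (A B : List V) : Setoid (G.Term A B) :=
  ⟨G.Rel, ⟨Rel.refl, Rel.symm, Rel.trans⟩⟩

end CausalGraph

/-- The objects of the causal theory of `G`: the words over the vertices of `G`. -/
@[ext] structure Cau {V : Type u} (G : CausalGraph V) where
  ofWord ::
  word : List V

namespace Cau

open CausalGraph

variable {V : Type u} {G : CausalGraph V}

instance : Category.{u} (Cau G) where
  Hom A B := Quotient (G.termSetoid A.word B.word)
  id A := Quotient.mk _ (Term.id A.word)
  comp f g := Quotient.map₂ Term.comp (fun _ _ h _ _ h' => Rel.comp_congr h h') f g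
  id_comp f := Quotient.inductionOn f fun f => Quotient.sound (Rel.id_comp f)
  comp_id f := Quotient.inductionOn f fun f => Quotient.sound (Rel.comp_id f)
  assoc f g h := Quotient.inductionOn₃ f g h fun f g h => Quotient.sound (Rel.assoc f g h)

/-- The morphism represented by a formal morphism. -/
def mk {A B : List V} (f : G.Term A B) : (ofWord A : Cau G) ⟶ ofWord B := Quotient.mk _ f

theorem mk_eq {A B : List V} {f g : G.Term A B} (h : G.Rel f g) : mk f = mk g := Quotient.sound h

theorem exists_mk {A B : Cau G} (f : A ⟶ B) : ∃ t : G.Term A.word B.word, mk t = f :=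
  Quotient.inductionOn f fun t => ⟨t, rfl⟩

/-- The identity morphism between two equal words. -/
def wordIso {A B : List V} (h : A = B) : (ofWord A : Cau G) ≅ ofWord B :=
  eqToIso (congrArg ofWord h)

theorem mk_ofEq {A B : List V} (h : A = B) : mk (Term.ofEq G h) = (wordIso h).hom := by
  subst h; rfl

theorem wordIso_trans {A B C : List V} (h : A = B) (h' : B = C) :
    (wordIso h : (ofWord A : Cau G) ≅ ofWord B).hom ≫ (wordIso h').hom =
      (wordIso (h.trans h')).hom := by
  simp [wordIso]

/-- Concatenation of words is the monoidal product on objects; the associators and the unitors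
are identities between equal words. -/
instance : MonoidalCategoryStruct (Cau G) where
  tensorObj A B := ofWord (A.word ++ B.word)
  tensorUnit := ofWord []
  tensorHom f g :=
    Quotient.map₂ Term.tensor (fun _ _ h _ _ h' => Rel.tensor_congr h h') f g
  whiskerLeft X _ _ f :=
    Quotient.map (Term.tensor (Term.id X.word)) (fun _ _ h => Rel.tensor_congr (Rel.refl _) h) f
  whiskerRight f X :=
    Quotient.map (fun t => Term.tensor t (Term.id X.word))
      (fun _ _ h => Rel.tensor_congr h (Rel.refl _)) f
  associator A B C := wordIso (List.append_assoc A.word B.word C.word)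
  leftUnitor A := wordIso (List.nil_append A.word)
  rightUnitor A := wordIso (List.append_nil A.word)

theorem mk_comp {A B C : List V} (f : G.Term A B) (g : G.Term B C) :
    mk (Term.comp f g) = mk f ≫ mk g := rfl

theorem mk_id (A : List V) : mk (Term.id A : G.Term A A) = 𝟙 (ofWord A) := rfl

theorem mk_tensor {A B C D : List V} (f : G.Term A B) (g : G.Term C D) :
    mk (Term.tensor f g) = mk f ⊗ₘ mk g := rfl

theorem tensor_wordIso {A B C D : List V} (h : A = B) (h' : C = D) :
    ((wordIso h).hom : (ofWord A : Cau G) ⟶ _) ⊗ₘ (wordIso h').hom =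
      (wordIso (show A ++ C = B ++ D by rw [h, h'])).hom := by
  subst h h'
  exact mk_eq (Rel.tensor_id A C)

theorem id_eq_wordIso (A : List V) : 𝟙 (ofWord A : Cau G) = (wordIso rfl).hom := rfl

instance : MonoidalCategory (Cau G) := MonoidalCategory.ofTensorHom
  (id_tensorHom_id := fun A B => mk_eq (Rel.tensor_id A.word B.word))
  (id_tensorHom := fun _ _ _ f => by obtain ⟨f, rfl⟩ := exists_mk f; rfl)
  (tensorHom_id := fun f _ => by obtain ⟨f, rfl⟩ := exists_mk f; rfl)
  (tensorHom_comp_tensorHom := fun f f' g g' => by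
    obtain ⟨f, rfl⟩ := exists_mk f
    obtain ⟨f', rfl⟩ := exists_mk f'
    obtain ⟨g, rfl⟩ := exists_mk g
    obtain ⟨g', rfl⟩ := exists_mk g'
    exact (mk_eq (Rel.tensor_comp f g f' g')).symm)
  (associator_naturality := fun f g h => by
    obtain ⟨f, rfl⟩ := exists_mk f
    obtain ⟨g, rfl⟩ := exists_mk g
    obtain ⟨h, rfl⟩ := exists_mk h
    have := mk_eq (Rel.tensor_assoc f g h)
    simp only [mk_comp, mk_ofEq] at this
    exact this)
  (leftUnitor_naturality := fun {X Y} f => by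
    obtain ⟨f, rfl⟩ := exists_mk f
    have h : (𝟙 (𝟙_ (Cau G)) ⊗ₘ mk f) = mk f := mk_eq (Rel.id_tensor f)
    rw [h]
    exact (Category.comp_id _).trans (Category.id_comp _).symm)
  (rightUnitor_naturality := fun f => by
    obtain ⟨f, rfl⟩ := exists_mk f
    have := mk_eq (Rel.tensor_id_nil f)
    simp only [mk_comp, mk_ofEq] at this
    exact this)
  (pentagon := fun W X Y Z => by
    have h₁ := tensor_wordIso (G := G) (List.append_assoc W.word X.word Y.word) (Eq.refl Z.word)
    have h₂ := tensor_wordIso (G := G) (Eq.refl W.word) (List.append_assoc X.word Y.word Z.word)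
    refine (congrArg₂ (fun a b => a ≫ _ ≫ b) h₁ h₂).trans ?_
    refine (congrArg (fun a => _ ≫ a) (wordIso_trans _ _)).trans ?_
    exact (wordIso_trans _ _).trans (wordIso_trans _ _).symm)
  (triangle := fun X Y => by
    have h₁ := tensor_wordIso (G := G) (Eq.refl X.word) (List.nil_append Y.word)
    have h₂ := tensor_wordIso (G := G) (List.append_nil X.word) (Eq.refl Y.word)
    refine (congrArg (fun a => _ ≫ a) h₁).trans ?_
    exact (wordIso_trans _ _).trans h₂.symm)

/-- The symmetry on two words. -/
def swapIso (A B : Cau G) : A ⊗ B ≅ B ⊗ A where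
  hom := mk (Term.swap A.word B.word)
  inv := mk (Term.swap B.word A.word)
  hom_inv_id := mk_eq (Rel.swap_swap A.word B.word)
  inv_hom_id := mk_eq (Rel.swap_swap B.word A.word)

theorem swapIso_hexagon (X Y Z : Cau G) :
    (α_ X Y Z).hom ≫ (swapIso X (Y ⊗ Z)).hom ≫ (α_ Y Z X).hom =
      ((swapIso X Y).hom ▷ Z) ≫ (α_ Y X Z).hom ≫ (Y ◁ (swapIso X Z).hom) := by
  have := mk_eq (Rel.hexagon (G := G) X.word Y.word Z.word)
  simp only [mk_comp, mk_ofEq] at this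
  exact this

instance : SymmetricCategory (Cau G) where
  braiding := swapIso
  braiding_naturality_right := fun X _ _ f => by
    obtain ⟨f, rfl⟩ := exists_mk f
    exact mk_eq (Rel.swap_natural (Term.id X.word) f)
  braiding_naturality_left := fun f X => by
    obtain ⟨f, rfl⟩ := exists_mk f
    exact mk_eq (Rel.swap_natural f (Term.id X.word))
  hexagon_forward := swapIso_hexagon
  hexagon_reverse := fun X Y Z => by
    have h : (α_ Z X Y ≪≫ swapIso Z (X ⊗ Y) ≪≫ α_ X Y Z) =
        (whiskerRightIso (swapIso Z X) Y ≪≫ α_ X Z Y ≪≫ whiskerLeftIso X (swapIso Z Y)) :=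
      Iso.ext (swapIso_hexagon Z X Y)
    have h' := congrArg Iso.inv h
    simp only [Iso.trans_inv, whiskerRightIso_inv, whiskerLeftIso_inv, Category.assoc] at h'
    exact h'
  symmetry := fun X Y => (swapIso X Y).hom_inv_id

instance (A : Cau G) : ComonObj A where
  counit := mk (Term.discard A.word)
  comul := mk (Term.copy A.word)
  counit_comul := by
    have h : mk (Term.copy A.word) ≫ (mk (Term.discard A.word) ▷ A) = 𝟙 A :=
      mk_eq (Rel.copy_discard_left (G := G) A.word)
    exact h
  comul_counit := by
    have h := mk_eq (Rel.copy_discard_right (G := G) A.word)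
    simp only [mk_comp, mk_ofEq] at h
    rw [← cancel_mono (ρ_ A).hom, Iso.inv_hom_id]
    exact h
  comul_assoc := by
    have h := mk_eq (Rel.copy_assoc (G := G) A.word)
    simp only [mk_comp, mk_ofEq, Category.assoc] at h
    exact h.symm

instance (A : Cau G) : IsCommComonObj A where
  comul_comm := mk_eq (Rel.copy_swap (G := G) A.word)

theorem discard_natural {A B : Cau G} (f : A ⟶ B) : f ≫ ε[B] = ε[A] := by
  obtain ⟨f, rfl⟩ := exists_mk f
  exact mk_eq (Rel.discard_natural f)

theorem discard_unit : ε[𝟙_ (Cau G)] = 𝟙 (𝟙_ (Cau G)) := by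
  have h : Δ[𝟙_ (Cau G)] ≫ ε[𝟙_ (Cau G)] ▷ 𝟙_ (Cau G) = 𝟙 (𝟙_ (Cau G)) :=
    mk_eq (Rel.copy_discard_left (G := G) [])
  have h' : ε[𝟙_ (Cau G)] ▷ 𝟙_ (Cau G) = ε[𝟙_ (Cau G)] := by
    have := mk_eq (Rel.tensor_id_nil (Term.discard (G := G) []))
    simp only [mk_comp, mk_ofEq] at this
    exact ((Category.comp_id _).symm.trans this).trans (Category.id_comp _)
  rw [h'] at h
  exact (discard_natural Δ[𝟙_ (Cau G)]).symm.trans h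

instance : MarkovCategory (Cau G) where
  copy_tensor := fun A B => by
    have h := mk_eq (Rel.copy_append (G := G) A.word B.word)
    simp only [mk_comp, mk_ofEq] at h
    have e₁ : (wordIso (show (A.word ++ A.word) ++ (B.word ++ B.word) =
          A.word ++ ((A.word ++ B.word) ++ B.word) by simp)).hom =
        (α_ A A (B ⊗ B)).hom ≫ A ◁ (α_ A B B).inv := by
      have := tensor_wordIso (G := G) (Eq.refl A.word)
        (List.append_assoc A.word B.word B.word).symm
      exact ((congrArg (fun a => (α_ A A (B ⊗ B)).hom ≫ a) this).trans (wordIso_trans _ _)).symm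
    have e₂ : (wordIso (show A.word ++ ((B.word ++ A.word) ++ B.word) =
          (A.word ++ B.word) ++ (A.word ++ B.word) by simp)).hom =
        A ◁ (α_ B A B).hom ≫ (α_ A B (A ⊗ B)).inv := by
      have := tensor_wordIso (G := G) (Eq.refl A.word)
        (List.append_assoc B.word A.word B.word)
      exact ((congrArg (fun a => a ≫ (α_ A B (A ⊗ B)).inv) this).trans
        (wordIso_trans _ (List.append_assoc A.word B.word (A.word ++ B.word)).symm)).symm
    rw [e₁, e₂] at h
    unfold tensorμ
    simp only [Category.assoc] at h
    exact h
  discard_tensor := fun A B => by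
    have h : ε[A ⊗ B] = ε[A] ⊗ₘ ε[B] := mk_eq (Rel.discard_append (G := G) A.word B.word)
    exact h.trans (Category.comp_id _).symm
  copy_unit := by
    have h : Δ[𝟙_ (Cau G)] ≫ ε[𝟙_ (Cau G)] ▷ 𝟙_ (Cau G) = (λ_ (𝟙_ (Cau G))).inv :=
      ComonObj.counit_comul _
    rw [discard_unit, id_whiskerRight] at h
    exact (Category.comp_id _).symm.trans h
  discard_unit := discard_unit
  discard_natural := discard_natural

end Cau

namespace CausalGraph

variable {V : Type u} (G : CausalGraph V)

/-- A word over the vertices, as an object of the causal theory. -/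
abbrev obj (A : List V) : Cau G := Cau.ofWord A

/-- The causal mechanism of the vertex `i`. -/
def mechanism (i : V) : G.obj (G.pa i) ⟶ G.obj [i] := Cau.mk (Term.mechanism i)

/-! ### Multipliers -/

open Classical in
/-- The multiplier that keeps the (first) letter `b` of the word and discards the others. -/
noncomputable def proj (b : V) : (A : List V) → b ∈ A → (G.obj A ⟶ G.obj [b])
  | [], h => absurd h List.not_mem_nil
  | a :: A, h =>
    if e : b = a then
      show G.obj [a] ⊗ G.obj A ⟶ G.obj [b] from
        G.obj [a] ◁ ε[G.obj A] ≫ (ρ_ (G.obj [a])).hom ≫ eqToHom (by rw [e])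
    else
      show G.obj [a] ⊗ G.obj A ⟶ G.obj [b] from
        ε[G.obj [a]] ▷ G.obj A ≫ (λ_ (G.obj A)).hom ≫
          proj b A ((List.mem_cons.mp h).resolve_left e)

/-- The multiplier `A ⟶ B` for a word `B` all of whose letters occur in `A`. If `A` is singular,
it is the only morphism `A ⟶ B` generated by duplicates, discards, symmetries and identities. -/
noncomputable def multiplier (A : List V) : (B : List V) → (∀ b ∈ B, b ∈ A) → (G.obj A ⟶ G.obj B)
  | [], _ => ε[G.obj A]
  | b :: B, h =>
    show G.obj A ⟶ G.obj [b] ⊗ G.obj B from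
      Δ[G.obj A] ≫ (G.proj b A (h b List.mem_cons_self) ⊗ₘ
        multiplier A B fun x hx => h x (List.mem_cons_of_mem b hx))

/-! ### Running causal mechanisms -/

/-- All parents of each vertex in the list `L` occur later in `L`, or in `t`. Read from right to
left, `L` is an order in which the mechanisms of its vertices can run once `t` is given. -/
def IsCausalOrder (t : List V) : List V → Prop
  | [] => True
  | i :: L => (∀ j ∈ G.pa i, j ∈ L ++ t) ∧ IsCausalOrder t L

/-- Starting from `t`, run the mechanisms of the vertices in `L`, from right to left, each one
on duplicates of the wires of the parents of its vertex, and keep all wires. -/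
noncomputable def run (t : List V) :
    (L : List V) → G.IsCausalOrder t L → (G.obj t ⟶ G.obj (L ++ t))
  | [], _ => 𝟙 (G.obj t)
  | i :: L, h =>
    show G.obj t ⟶ G.obj [i] ⊗ G.obj (L ++ t) from
      run t L h.2 ≫ Δ[G.obj (L ++ t)] ≫
        (G.multiplier (L ++ t) (G.pa i) h.1 ≫ G.mechanism i) ▷ G.obj (L ++ t)

/-! ### Causal effects -/

/-- The vertices of the subgraph of `G` that consists of the vertices in `t` and `v` and all
directed paths that end in `v` and do not pass through or end in `t` (but may start in `t`). -/
def effectVertices (t v : List V) : Set V :=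
  {i | i ∈ t ∨ ∃ j ∈ v, ∃ p, G.IsDirectedPath i j p ∧ ∀ x ∈ p.tail, x ∉ t}

theorem mem_effectVertices_of_mem {t v : List V} {i : V} (h : i ∈ v) :
    i ∈ G.effectVertices t v :=
  Or.inr ⟨i, h, [i], ⟨List.isChain_singleton i, rfl, rfl⟩, by simp⟩

theorem parent_mem_effectVertices {t v : List V} {i j : V} (h : i ∈ G.effectVertices t v)
    (hi : i ∉ t) (hj : j ∈ G.pa i) : j ∈ G.effectVertices t v := by
  obtain h | ⟨k, hk, p, ⟨hp, hp₁, hp₂⟩, hpt⟩ := h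
  · exact absurd h hi
  · cases p with
    | nil => simp at hp₁
    | cons a p =>
      obtain rfl : a = i := by simpa using hp₁
      refine Or.inr ⟨k, hk, j :: a :: p, ⟨?_, rfl, ?_⟩, ?_⟩
      · exact List.isChain_cons_cons.mpr ⟨(G.mem_pa j a).mp hj, hp⟩
      · simpa using hp₂
      · intro x hx
        rcases List.mem_cons.mp hx with rfl | hx
        · exact hi
        · exact hpt x hx

/-- The vertices of a finite acyclic graph can be listed in a causal order. -/
theorem exists_causalOrder [Finite V] :
    ∃ L : List V, L.Nodup ∧ (∀ i, i ∈ L) ∧ G.IsCausalOrder [] L := by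
  classical
  have := Fintype.ofFinite V
  let r : V → ℕ := fun i => {j | Relation.TransGen G.Adj j i}.ncard
  have hr : ∀ i j, G.Adj i j → r i < r j := fun i j h =>
    Set.ncard_lt_ncard
      (Set.ssubset_iff_of_subset (fun k hk => Relation.TransGen.tail hk h) |>.mpr
        ⟨i, Relation.TransGen.single h, G.acyclic i⟩) (Set.toFinite _)
  let le : V → V → Bool := fun i j => decide (r j ≤ r i)
  have hperm := List.mergeSort_perm (Finset.univ : Finset V).toList le
  have hsort : ((Finset.univ : Finset V).toList.mergeSort le).Pairwise (fun i j => r j ≤ r i) := by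
    have := List.pairwise_mergeSort (le := le) (by simp only [le, decide_eq_true_eq]; omega)
      (by simp only [le, Bool.or_eq_true, decide_eq_true_eq]; omega)
      (Finset.univ : Finset V).toList
    simpa [le] using this
  have key : ∀ L : List V, L.Pairwise (fun i j => r j ≤ r i) →
      (∀ i ∈ L, ∀ j ∈ G.pa i, j ∈ L) → G.IsCausalOrder [] L := by
    intro L
    induction L with
    | nil => exact fun _ _ => trivial
    | cons a L ih =>
      intro hL hpa
      have hlt : ∀ i ∈ a :: L, ∀ j ∈ G.pa i, j ∈ L := by
        intro i hi j hj
        rcases List.mem_cons.mp (hpa i hi j hj) with rfl | h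
        · have h₁ := hr j i ((G.mem_pa j i).mp hj)
          rcases List.mem_cons.mp hi with rfl | hi
          · omega
          · have := (List.pairwise_cons.mp hL).1 i hi
            omega
        · exact h
      refine ⟨fun j hj => ?_, ih hL.of_cons fun i hi => hlt i (List.mem_cons_of_mem a hi)⟩
      simpa using hlt a List.mem_cons_self j hj
  refine ⟨_, hperm.nodup_iff.mpr (Finset.nodup_toList _), fun i => hperm.mem_iff.mpr (by simp),
    key _ hsort fun i _ j _ => hperm.mem_iff.mpr (by simp)⟩

/-- A causal order of the vertices: every vertex precedes its parents. -/
noncomputable def order [Finite V] : List V := G.exists_causalOrder.choose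

theorem mem_order [Finite V] (i : V) : i ∈ G.order := G.exists_causalOrder.choose_spec.2.1 i

open Classical in
/-- The vertices whose mechanisms occur in the causal effect of `t` on `v`, in causal order. -/
noncomputable def effectOrder [Finite V] (t v : List V) : List V :=
  G.order.filter fun i => i ∈ G.effectVertices t v ∧ i ∉ t

theorem isCausalOrder_effectOrder [Finite V] (t v : List V) :
    G.IsCausalOrder t (G.effectOrder t v) := by
  classical
  have key : ∀ L : List V, G.IsCausalOrder [] L →
      G.IsCausalOrder t (L.filter fun i => i ∈ G.effectVertices t v ∧ i ∉ t) := by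
    intro L
    induction L with
    | nil => exact fun _ => trivial
    | cons a L ih =>
      intro h
      by_cases ha : a ∈ G.effectVertices t v ∧ a ∉ t
      · rw [List.filter_cons_of_pos (by simpa using ha)]
        refine ⟨fun j hj => ?_, ih h.2⟩
        have h₁ := G.parent_mem_effectVertices ha.1 ha.2 hj
        have h₂ : j ∈ L := by simpa using h.1 j hj
        by_cases hjt : j ∈ t
        · exact List.mem_append_right _ hjt
        · exact List.mem_append_left _ (by simpa using ⟨h₂, h₁, hjt⟩)
      · rw [List.filter_cons_of_neg (by simpa using ha)]
        exact ih h.2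
  exact key _ G.exists_causalOrder.choose_spec.2.2

theorem mem_effectOrder_append [Finite V] {t v : List V} : ∀ i ∈ v, i ∈ G.effectOrder t v ++ t := by
  classical
  intro i hi
  by_cases hit : i ∈ t
  · exact List.mem_append_right _ hit
  · exact List.mem_append_left _ (List.mem_filter.mpr
      ⟨G.mem_order i, by simpa using ⟨G.mem_effectVertices_of_mem hi, hit⟩⟩)

/-- The causal effect `[v ‖ t] : t ⟶ v`: the mechanisms of all vertices of `effectVertices t v`
outside `t` are run on the input `t`, and the wires of the letters of `v` are output, in the order
of `v`. Each wire is kept and duplicated whenever a child consumes it, and a wire that is not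
output is discarded at the end; by the comonoid laws this is the same morphism as duplicating
each wire at once into the number of copies that are needed, and by naturality it does not depend
on the causal order. -/
noncomputable def effect [Finite V] (t v : List V) : G.obj t ⟶ G.obj v :=
  G.run t (G.effectOrder t v) (G.isCausalOrder_effectOrder t v) ≫
    G.multiplier (G.effectOrder t v ++ t) v G.mem_effectOrder_append

/-! ### Images of causal effects under a strong Markov functor -/

section Model

variable [Finite V] {M : Type*} [Category M] [MonoidalCategory M] [MarkovCategory M]
  (F : Cau G ⥤ M) [F.Braided]

/-- `F([vw ‖ u])`, as a morphism to `F(v) ⊗ F(w) ≅ F(vw)`. -/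
noncomputable def jointEffect (u v w : List V) :
    F.obj (G.obj u) ⟶ F.obj (G.obj v) ⊗ F.obj (G.obj w) :=
  F.map (G.effect u (v ++ w)) ≫ Functor.OplaxMonoidal.δ F (G.obj v) (G.obj w)

/-- `F([w ‖ uv])`, as a morphism from `F(v) ⊗ F(u) ≅ F(u) ⊗ F(v) ≅ F(uv)`. -/
noncomputable def pairEffect (u v w : List V) :
    F.obj (G.obj v) ⊗ F.obj (G.obj u) ⟶ F.obj (G.obj w) :=
  (β_ (F.obj (G.obj v)) (F.obj (G.obj u))).hom ≫
    Functor.LaxMonoidal.μ F (G.obj u) (G.obj v) ≫ F.map (G.effect (u ++ v) w)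

end Model

end CausalGraph

/-! A strong Markov functor preserves disintegrations and discarded inputs (`map_disintegrate`,
`map_ignoreFst`), so everything reduces to two identities between causal effects in `Cau G`.

Both depend only on which mechanisms occur. The diagram of [v‖u] contains the vertices with a
directed path to v that avoids u. A path to v or w that avoids u either meets v, and can be cut
there, or avoids v and ends in w. Hence the mechanisms of [vw‖u] are those of [v‖u] together with
those of [w‖uv]. A vertex in both blocks starts a path to v and a path to w, both avoiding u and the
second avoiding v; shortening them yields a proper backward trek without a vertex in u. So backward
separation makes the blocks disjoint, and [vw‖u] can run the block of [v‖u] first and then, on the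
wires of u and v, that of [w‖uv]. This is the disintegration (`BackwardTSeparated.effect_append`).
An overlap is the obstruction: the disintegration would run a common mechanism twice, and mechanisms
do not commute with duplication. Under forward separation, a path to w that avoids u cannot meet v,
so [w‖uv] and [w‖u] have the same mechanisms and the wires of v go unused
(`ForwardTSeparated.braiding_effect`). With both separations, the disintegration has a conditional
that ignores v and collapses to the pairing of [v‖u] and [w‖u], which is conditional independence.

The diagrams are handled by a calculus of pairings. These are not categorical pairings:
precomposition distributes over them for deterministic morphisms (`IsDet.comp_pair`), not in
general. Multipliers are deterministic and compose to multipliers, which turns wiring into list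
membership. The lemmas on `run` reorder, restrict and concatenate sequences of mechanisms; they are
stated up to a final multiplier into a word `D`, because different orders end on different words. -/

namespace MarkovNotions

/-! ### Calculus of pairings in a Markov category -/

variable {C : Type*} [Category C] [MonoidalCategory C] [MarkovCategory C]

/-- The pairing of two morphisms with the same source: duplicate the input and feed one copy
to each of them. -/
def pair {X Y Z : C} (f : Z ⟶ X) (g : Z ⟶ Y) : Z ⟶ X ⊗ Y := Δ[Z] ≫ (f ⊗ₘ g)

/-- The projection that discards the second factor. -/
def fst (X Y : C) : X ⊗ Y ⟶ X := X ◁ ε[Y] ≫ (ρ_ X).hom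

/-- The projection that discards the first factor. -/
def snd (X Y : C) : X ⊗ Y ⟶ Y := ε[X] ▷ Y ≫ (λ_ Y).hom

variable {W X Y Z X' Y' : C}

theorem hom_unit_ext (f g : X ⟶ 𝟙_ C) : f = g := Subsingleton.elim f g

@[simp]
theorem pair_tensorHom (f : Z ⟶ X) (g : Z ⟶ Y) (a : X ⟶ X') (b : Y ⟶ Y') :
    pair f g ≫ (a ⊗ₘ b) = pair (f ≫ a) (g ≫ b) := by
  simp [pair]

@[simp]
theorem pair_whiskerLeft (f : Z ⟶ X) (g : Z ⟶ Y) (b : Y ⟶ Y') :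
    pair f g ≫ X ◁ b = pair f (g ≫ b) := by
  rw [← id_tensorHom, pair_tensorHom, Category.comp_id]

@[simp]
theorem pair_whiskerRight (f : Z ⟶ X) (g : Z ⟶ Y) (a : X ⟶ X') :
    pair f g ≫ a ▷ Y = pair (f ≫ a) g := by
  rw [← tensorHom_id, pair_tensorHom, Category.comp_id]

@[simp]
theorem pair_associator (f : Z ⟶ W) (g : Z ⟶ X) (h : Z ⟶ Y) :
    pair (pair f g) h ≫ (α_ W X Y).hom = pair f (pair g h) := by
  have h₁ : (Δ[Z] ≫ (f ⊗ₘ g)) ⊗ₘ h = Δ[Z] ▷ Z ≫ ((f ⊗ₘ g) ⊗ₘ h) := by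
    rw [← tensorHom_id, tensorHom_comp_tensorHom, Category.id_comp]
  have h₂ : f ⊗ₘ (Δ[Z] ≫ (g ⊗ₘ h)) = Z ◁ Δ[Z] ≫ (f ⊗ₘ (g ⊗ₘ h)) := by
    rw [← id_tensorHom, tensorHom_comp_tensorHom, Category.id_comp]
  simp only [pair, h₁, h₂, Category.assoc, associator_naturality]
  rw [ComonObj.comul_assoc_assoc]

@[simp]
theorem pair_associator_inv (f : Z ⟶ W) (g : Z ⟶ X) (h : Z ⟶ Y) :
    pair f (pair g h) ≫ (α_ W X Y).inv = pair (pair f g) h := by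
  rw [← pair_associator, Category.assoc, Iso.hom_inv_id, Category.comp_id]

@[simp]
theorem pair_braiding (f : Z ⟶ X) (g : Z ⟶ Y) : pair f g ≫ (β_ X Y).hom = pair g f := by
  simp only [pair, Category.assoc, BraidedCategory.braiding_naturality]
  rw [IsCommComonObj.comul_comm_assoc]

theorem pair_discard_right (f : Z ⟶ X) (g : Z ⟶ 𝟙_ C) : pair f g ≫ (ρ_ X).hom = f := by
  have h : pair f g = pair (𝟙 Z) ε[Z] ≫ f ▷ 𝟙_ C := by
    rw [pair_whiskerRight, Category.id_comp, hom_unit_ext g]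
  rw [h, Category.assoc, rightUnitor_naturality, pair, id_tensorHom]
  simp

theorem pair_discard_left (f : Z ⟶ 𝟙_ C) (g : Z ⟶ X) : pair f g ≫ (λ_ X).hom = g := by
  have h : pair f g = pair ε[Z] (𝟙 Z) ≫ 𝟙_ C ◁ g := by
    rw [pair_whiskerLeft, Category.id_comp, hom_unit_ext f]
  rw [h, Category.assoc, leftUnitor_naturality, pair, tensorHom_id]
  simp

@[simp]
theorem pair_fst (f : Z ⟶ X) (g : Z ⟶ Y) : pair f g ≫ fst X Y = f := by
  simp only [fst, ← Category.assoc, pair_whiskerLeft, pair_discard_right]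

@[simp]
theorem pair_snd (f : Z ⟶ X) (g : Z ⟶ Y) : pair f g ≫ snd X Y = g := by
  simp only [snd, ← Category.assoc, pair_whiskerRight, pair_discard_left]

theorem copy_eq_pair (X : C) : Δ[X] = pair (𝟙 X) (𝟙 X) := by simp [pair]

/-! ### Deterministic morphisms and projections -/

/-- Morphisms that commute with duplication. -/
def IsDet (f : X ⟶ Y) : Prop := f ≫ pair (𝟙 Y) (𝟙 Y) = pair f f

/-- Deterministic morphisms distribute over pairings. -/
theorem IsDet.comp_pair {e : W ⟶ Z} (he : IsDet e) (f : Z ⟶ X) (g : Z ⟶ Y) :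
    e ≫ pair f g = pair (e ≫ f) (e ≫ g) := by
  have h : pair f g = pair (𝟙 Z) (𝟙 Z) ≫ (f ⊗ₘ g) := by simp
  rw [h, ← Category.assoc, he, pair_tensorHom]

theorem IsDet.comp {f : X ⟶ Y} {g : Y ⟶ Z} (hf : IsDet f) (hg : IsDet g) : IsDet (f ≫ g) := by
  rw [IsDet, Category.assoc, hg, hf.comp_pair]

theorem pair_pair_tensorμ (f : Z ⟶ W) (g : Z ⟶ X) (f' : Z ⟶ X') (g' : Z ⟶ Y) :
    pair (pair f g) (pair f' g') ≫ tensorμ W X X' Y = pair (pair f f') (pair g g') := by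
  simp only [tensorμ, ← Category.assoc, pair_associator, pair_whiskerLeft, pair_associator_inv,
    pair_whiskerRight, pair_braiding]

theorem isDet_unit (f : Z ⟶ 𝟙_ C) : IsDet f := by
  rw [IsDet, ← cancel_mono (λ_ (𝟙_ C)).hom]
  exact hom_unit_ext _ _

theorem pair_id_id_tensor (X Y : C) : pair (𝟙 (X ⊗ Y)) (𝟙 (X ⊗ Y)) =
    (pair (𝟙 X) (𝟙 X) ⊗ₘ pair (𝟙 Y) (𝟙 Y)) ≫ tensorμ X X Y Y := by
  rw [← copy_eq_pair, ← copy_eq_pair, ← copy_eq_pair]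
  exact CopyDiscardCategory.copy_tensor X Y

theorem isDet_pair {f : Z ⟶ X} {g : Z ⟶ Y} (hf : IsDet f) (hg : IsDet g) :
    IsDet (pair f g) := by
  rw [IsDet, pair_id_id_tensor, ← Category.assoc, pair_tensorHom, hf, hg, pair_pair_tensorμ]

/-- Duplication on a product is componentwise up to `tensorμ`. The two discards slide through
`tensorμ`, where they leave only the braiding of the unit with itself, and the counit laws finish.
In general a morphism into a product is not the pairing of its marginals; the identity is, and this
lets structural maps be computed on pairings. -/
theorem pair_fst_snd (X Y : C) : pair (fst X Y) (snd X Y) = 𝟙 (X ⊗ Y) := by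
  have h : pair (fst X Y) (snd X Y) = pair (𝟙 (X ⊗ Y)) (𝟙 (X ⊗ Y)) ≫
      (X ◁ ε[Y] ⊗ₘ ε[X] ▷ Y) ≫ ((ρ_ X).hom ⊗ₘ (λ_ Y).hom) := by
    rw [← Category.assoc, pair_tensorHom, pair_tensorHom, Category.id_comp, Category.id_comp]
    rfl
  have h₁ : tensorμ X X Y Y ≫ (X ◁ ε[Y] ⊗ₘ ε[X] ▷ Y) =
      (X ◁ ε[X] ⊗ₘ ε[Y] ▷ Y) ≫ tensorμ X (𝟙_ C) (𝟙_ C) Y := by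
    rw [← id_tensorHom, ← id_tensorHom, ← tensorHom_id, ← tensorHom_id, tensorμ_natural]
  have h₂ : tensorμ X (𝟙_ C) (𝟙_ C) Y = 𝟙 _ := by
    have : (β_ (𝟙_ C) (𝟙_ C)).hom = 𝟙 _ := by
      rw [← cancel_mono (λ_ (𝟙_ C)).hom]; exact hom_unit_ext _ _
    simp [tensorμ, this]
  rw [h, pair_id_id_tensor, Category.assoc, reassoc_of% h₁, h₂, Category.id_comp,
    tensorHom_comp_tensorHom, tensorHom_comp_tensorHom]
  change (pair (𝟙 X) (𝟙 X) ≫ fst X X ⊗ₘ pair (𝟙 Y) (𝟙 Y) ≫ snd Y Y) = _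
  rw [pair_fst, pair_snd, id_tensorHom_id]

theorem tensorμ_fst_fst (X Y : C) :
    tensorμ X X Y Y ≫ (fst X Y ⊗ₘ fst X Y) = fst (X ⊗ X) (Y ⊗ Y) := by
  have h₁ : tensorμ X X Y Y ≫ (X ◁ ε[Y] ⊗ₘ X ◁ ε[Y]) =
      (X ⊗ X) ◁ (ε[Y] ⊗ₘ ε[Y]) ≫ tensorμ X X (𝟙_ C) (𝟙_ C) := by
    rw [← id_tensorHom, ← tensorμ_natural, id_tensorHom_id, id_tensorHom]
  have h₂ : tensorμ X X (𝟙_ C) (𝟙_ C) ≫ tensorμ X (𝟙_ C) X (𝟙_ C) = 𝟙 _ := by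
    simp [tensorμ]
  rw [fst, ← tensorHom_comp_tensorHom, reassoc_of% h₁, rightUnitor_monoidal, reassoc_of% h₂, fst,
    ← MonoidalCategory.whiskerLeft_comp_assoc]
  congr 2
  exact hom_unit_ext _ _

theorem tensorμ_snd_snd (X Y : C) :
    tensorμ X X Y Y ≫ (snd X Y ⊗ₘ snd X Y) = snd (X ⊗ X) (Y ⊗ Y) := by
  have h₁ : tensorμ X X Y Y ≫ (ε[X] ▷ Y ⊗ₘ ε[X] ▷ Y) =
      (ε[X] ⊗ₘ ε[X]) ▷ (Y ⊗ Y) ≫ tensorμ (𝟙_ C) (𝟙_ C) Y Y := by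
    rw [← tensorHom_id, ← tensorμ_natural, id_tensorHom_id, tensorHom_id]
  have h₂ : tensorμ (𝟙_ C) (𝟙_ C) Y Y ≫ tensorμ (𝟙_ C) Y (𝟙_ C) Y = 𝟙 _ := by
    simp [tensorμ]
  rw [snd, ← tensorHom_comp_tensorHom, reassoc_of% h₁, leftUnitor_monoidal, reassoc_of% h₂, snd,
    ← MonoidalCategory.comp_whiskerRight_assoc]
  congr 2
  exact hom_unit_ext _ _

/-- The componentwise formula for duplication on `X ⊗ Y` is preceded by the identity, written as a
pairing of projections, and followed by `fst ⊗ₘ fst`. One side becomes the pairing of `fst` with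
itself, the other the duplication of its output. -/
theorem isDet_fst (X Y : C) : IsDet (fst X Y) := by
  have h := congrArg (fun f => pair (fst X Y) (snd X Y) ≫ f ≫ (fst X Y ⊗ₘ fst X Y))
    (pair_id_id_tensor X Y)
  simp only [Category.assoc, tensorμ_fst_fst, pair_tensorHom, Category.id_comp] at h
  rw [← Category.assoc, pair_tensorHom, pair_fst, pair_fst_snd, Category.id_comp] at h
  exact h.symm

theorem isDet_snd (X Y : C) : IsDet (snd X Y) := by
  have h := congrArg (fun f => pair (fst X Y) (snd X Y) ≫ f ≫ (snd X Y ⊗ₘ snd X Y))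
    (pair_id_id_tensor X Y)
  simp only [Category.assoc, tensorμ_snd_snd, pair_tensorHom, Category.id_comp] at h
  rw [← Category.assoc, pair_tensorHom, pair_snd, pair_fst_snd, Category.id_comp] at h
  exact h.symm

/-- A morphism that keeps its input may be followed by a duplication of this input. -/
theorem pair_id_comp_pair_snd_id (f : Z ⟶ X) (g : Z ⟶ Y) :
    pair f (𝟙 Z) ≫ pair (snd X Z ≫ g) (𝟙 (X ⊗ Z)) = pair g (pair f (𝟙 Z)) := by
  -- As `f` is arbitrary, `pair f (𝟙 Z)` need not be deterministic and `IsDet.comp_pair` is not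
  -- available. The duplication of the `Z` wire is therefore written with structural maps, whose
  -- action on pairings holds for all morphisms.
  have h : pair (snd X Z) (𝟙 (X ⊗ Z)) =
      X ◁ Δ[Z] ≫ (α_ X Z Z).inv ≫ (β_ X Z).hom ▷ Z ≫ (α_ Z X Z).hom := by
    have h₁ : X ◁ Δ[Z] = pair (fst X Z) (pair (snd X Z) (snd X Z)) := by
      rw [← (isDet_snd X Z), ← pair_whiskerLeft, pair_fst_snd, Category.id_comp, copy_eq_pair]
    rw [h₁, ← pair_fst_snd]
    simp only [← Category.assoc, pair_associator_inv, pair_whiskerRight, pair_braiding,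
      pair_associator]
  have h₂ : pair (snd X Z ≫ g) (𝟙 (X ⊗ Z)) = pair (snd X Z) (𝟙 (X ⊗ Z)) ≫ g ▷ (X ⊗ Z) := by
    rw [pair_whiskerRight]
  rw [h₂, h]
  simp only [← Category.assoc, pair_whiskerLeft, Category.id_comp, copy_eq_pair,
    pair_associator_inv, pair_whiskerRight, pair_braiding, pair_associator]

/-- Exchanging the first two of three factors. -/
theorem pair_pair_comp_exchange (f : W ⟶ X) (g : W ⟶ Y) (h : W ⟶ Z) :
    pair f (pair g h) ≫ pair (snd X (Y ⊗ Z) ≫ fst Y Z)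
      (pair (fst X (Y ⊗ Z)) (snd X (Y ⊗ Z) ≫ snd Y Z)) = pair g (pair f h) := by
  have h₁ : 𝟙 (X ⊗ Y ⊗ Z) = pair (fst X (Y ⊗ Z))
      (pair (snd X (Y ⊗ Z) ≫ fst Y Z) (snd X (Y ⊗ Z) ≫ snd Y Z)) := by
    rw [← (isDet_snd X (Y ⊗ Z)).comp_pair, pair_fst_snd, Category.comp_id, pair_fst_snd]
  -- Again the exchange is expressed by associators and a braiding, so that no determinism of `f`,
  -- `g`, `h` is needed.
  have h₂ : pair (snd X (Y ⊗ Z) ≫ fst Y Z)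
      (pair (fst X (Y ⊗ Z)) (snd X (Y ⊗ Z) ≫ snd Y Z)) =
      (α_ X Y Z).inv ≫ (β_ X Y).hom ▷ Z ≫ (α_ Y X Z).hom := by
    rw [← Category.id_comp ((α_ X Y Z).inv ≫ _), h₁]
    simp only [← Category.assoc, pair_associator_inv, pair_whiskerRight, pair_braiding,
      pair_associator]
  rw [h₂]
  simp only [← Category.assoc, pair_associator_inv, pair_whiskerRight, pair_braiding,
    pair_associator]

theorem braiding_eq_pair (X Y : C) : (β_ X Y).hom = pair (snd X Y) (fst X Y) := by
  rw [← Category.id_comp (β_ X Y).hom, ← pair_fst_snd, pair_braiding]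

/-! ### Disintegrations and marginals in terms of pairings -/

theorem disintegrate_eq (h : Z ⟶ X) (g : X ⊗ Z ⟶ Y) :
    disintegrate h g = pair (h ≫ pair (𝟙 X) (𝟙 X)) (𝟙 Z) ≫ (α_ X X Z).hom ≫ X ◁ g := by
  rw [disintegrate, copy_eq_pair, copy_eq_pair, ← Category.assoc, pair_whiskerRight,
    Category.id_comp]

theorem ignoreFst_eq (X : C) (g : Z ⟶ Y) : ignoreFst X g = snd X Z ≫ g := by
  simp [ignoreFst, snd]

theorem marginalFst_eq (f : Z ⟶ X ⊗ Y) : marginalFst f = f ≫ fst X Y := rfl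

theorem marginalSnd_eq (f : Z ⟶ X ⊗ Y) : marginalSnd f = f ≫ snd X Y := rfl

theorem whiskerLeft_fst (X : C) (g : Y ⟶ Y') : X ◁ g ≫ fst X Y' = fst X Y := by
  rw [fst, ← MonoidalCategory.whiskerLeft_comp_assoc, MarkovCategory.discard_natural, fst]

/-- Discarding the output of `g` discards its inputs, by naturality of discards, and only one copy
of the output of `h` is left. Hence any disintegration through `g` exhibits `g` as a conditional. -/
theorem marginalFst_disintegrate (h : Z ⟶ X) (g : X ⊗ Z ⟶ Y) :
    marginalFst (disintegrate h g) = h := by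
  have h₁ : (α_ X X Z).hom ≫ fst X (X ⊗ Z) = fst (X ⊗ X) Z ≫ fst X X := by
    have h₂ : 𝟙 ((X ⊗ X) ⊗ Z) = pair (pair (fst (X ⊗ X) Z ≫ fst X X) (fst (X ⊗ X) Z ≫ snd X X))
        (snd (X ⊗ X) Z) := by
      rw [← (isDet_fst (X ⊗ X) Z).comp_pair, pair_fst_snd, Category.comp_id, pair_fst_snd]
    rw [← Category.id_comp (α_ X X Z).hom, h₂, pair_associator, pair_fst]
  rw [marginalFst_eq, disintegrate_eq, Category.assoc, Category.assoc, whiskerLeft_fst, h₁,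
    ← Category.assoc, pair_fst, Category.assoc, pair_fst, Category.comp_id]

/-- The copy of the output of `h` that is fed to the conditional is discarded at once. This is the
passage from a disintegration to conditional independence. -/
theorem disintegrate_ignoreFst (h : Z ⟶ X) (g : Z ⟶ Y) :
    disintegrate h (ignoreFst X g) = pair h g := by
  have h₂ : (α_ X X Z).hom ≫ X ◁ snd X Z = fst X X ▷ Z := by
    have h₂ : 𝟙 ((X ⊗ X) ⊗ Z) = pair (pair (fst (X ⊗ X) Z ≫ fst X X) (fst (X ⊗ X) Z ≫ snd X X))
        (snd (X ⊗ X) Z) := by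
      rw [← (isDet_fst (X ⊗ X) Z).comp_pair, pair_fst_snd, Category.comp_id, pair_fst_snd]
    rw [← Category.id_comp (α_ X X Z).hom, ← Category.id_comp (fst X X ▷ Z), h₂, pair_associator,
      pair_whiskerLeft, pair_snd, pair_whiskerRight, pair_fst]
  rw [disintegrate_eq, ignoreFst_eq, MonoidalCategory.whiskerLeft_comp, reassoc_of% h₂,
    ← Category.assoc, pair_whiskerRight, Category.assoc, pair_fst, pair_whiskerLeft,
    Category.comp_id, Category.id_comp]

theorem condIndep_pair (f : Z ⟶ X) (g : Z ⟶ Y) : CondIndep (pair f g) := by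
  rw [CondIndep, marginalFst_eq, marginalSnd_eq, pair_fst, pair_snd, pair]

end MarkovNotions

namespace CausalGraph

open MarkovNotions

variable {V : Type u} (G : CausalGraph V)

/-! ### Pairings on words -/

section Words

variable {G} {X Y : Cau G} {a b : V} {A B : List V}

/-- The pairing of a letter and a word. -/
def wcons (f : X ⟶ G.obj [a]) (g : X ⟶ G.obj A) : X ⟶ G.obj (a :: A) := pair f g

/-- The pairing of two words. -/
def wpair (f : X ⟶ G.obj A) (g : X ⟶ G.obj B) : X ⟶ G.obj (A ++ B) := pair f g

variable (G) in
/-- The projection to the first letter. -/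
def head (a : V) (A : List V) : G.obj (a :: A) ⟶ G.obj [a] := fst (G.obj [a]) (G.obj A)

variable (G) in
/-- The projection to all letters but the first. -/
def tail (a : V) (A : List V) : G.obj (a :: A) ⟶ G.obj A := snd (G.obj [a]) (G.obj A)

@[simp]
theorem wcons_head (f : X ⟶ G.obj [a]) (g : X ⟶ G.obj A) : wcons f g ≫ G.head a A = f :=
  pair_fst f g

@[simp]
theorem wcons_tail (f : X ⟶ G.obj [a]) (g : X ⟶ G.obj A) : wcons f g ≫ G.tail a A = g :=
  pair_snd f g

theorem wcons_head_tail (a : V) (A : List V) : wcons (G.head a A) (G.tail a A) = 𝟙 _ :=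
  pair_fst_snd (G.obj [a]) (G.obj A)

theorem isDet_head (a : V) (A : List V) : IsDet (G.head a A) := isDet_fst (G.obj [a]) (G.obj A)

theorem isDet_tail (a : V) (A : List V) : IsDet (G.tail a A) := isDet_snd (G.obj [a]) (G.obj A)

theorem isDet_wcons {f : X ⟶ G.obj [a]} {g : X ⟶ G.obj A} (hf : IsDet f) (hg : IsDet g) :
    IsDet (wcons f g) :=
  isDet_pair hf hg

theorem comp_wcons {e : Y ⟶ X} (he : IsDet e) (f : X ⟶ G.obj [a]) (g : X ⟶ G.obj A) :
    e ≫ wcons f g = wcons (e ≫ f) (e ≫ g) :=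
  he.comp_pair f g

theorem wcons_comp_wcons_head_tail (f : X ⟶ G.obj [a]) (g : X ⟶ G.obj A)
    (h : G.obj A ⟶ G.obj B) :
    wcons f g ≫ wcons (G.head a A) (G.tail a A ≫ h) = wcons f (g ≫ h) := by
  have h₁ : wcons (G.head a A) (G.tail a A ≫ h) = G.obj [a] ◁ h :=
    (pair_whiskerLeft (fst (G.obj [a]) (G.obj A)) (snd (G.obj [a]) (G.obj A)) h).symm.trans
      (by rw [pair_fst_snd]; exact Category.id_comp _)
  rw [h₁]
  exact pair_whiskerLeft f g h

/-- The two bracketings agree by definition when the first word is a single letter, so this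
associator is definitionally the identity. -/
theorem wpair_wcons (f : X ⟶ G.obj [a]) (g : X ⟶ G.obj A) (h : X ⟶ G.obj B) :
    wpair (wcons f g) h = wcons f (wpair g h) :=
  (Category.comp_id _).symm.trans (pair_associator f g h)

theorem wpair_nil (f : X ⟶ G.obj []) (g : X ⟶ G.obj A) : wpair f g = g :=
  (Category.comp_id _).symm.trans (pair_discard_left f g)

end Words

/-! ### The calculus of multipliers -/

theorem proj_self (b : V) (A : List V) (h : b ∈ b :: A) : G.proj b (b :: A) h = G.head b A := by
  rw [proj, dif_pos rfl]
  exact congrArg (fun f => G.obj [b] ◁ ε[G.obj A] ≫ f) (Category.comp_id _)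

theorem proj_of_ne {a b : V} (e : b ≠ a) (A : List V) (h : b ∈ a :: A) (h' : b ∈ A) :
    G.proj b (a :: A) h = G.tail a A ≫ G.proj b A h' := by
  rw [proj, dif_neg e]
  exact (Category.assoc _ _ _).symm

theorem multiplier_cons (A : List V) (b : V) (B : List V) (h : ∀ x ∈ b :: B, x ∈ A)
    (hb : b ∈ A) (hB : ∀ x ∈ B, x ∈ A) :
    G.multiplier A (b :: B) h = wcons (G.proj b A hb) (G.multiplier A B hB) := rfl

theorem isDet_proj (b : V) (A : List V) (h : b ∈ A) : IsDet (G.proj b A h) := by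
  induction A with
  | nil => simp at h
  | cons a A ih =>
    by_cases e : b = a
    · subst e
      rw [proj_self]
      exact isDet_head b A
    · rw [G.proj_of_ne e A h ((List.mem_cons.mp h).resolve_left e)]
      exact (isDet_tail a A).comp (ih _)

theorem isDet_multiplier (A B : List V) (h : ∀ x ∈ B, x ∈ A) : IsDet (G.multiplier A B h) := by
  induction B with
  | nil => exact isDet_unit (C := Cau G) _
  | cons b B ih => exact isDet_wcons (G.isDet_proj b A _) (ih _)

theorem multiplier_proj (A B : List V) (h : ∀ x ∈ B, x ∈ A) (c : V) (hc : c ∈ B) (hc' : c ∈ A) :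
    G.multiplier A B h ≫ G.proj c B hc = G.proj c A hc' := by
  induction B with
  | nil => simp at hc
  | cons b B ih =>
    have hB : ∀ x ∈ B, x ∈ A := fun x hx => h x (List.mem_cons_of_mem b hx)
    rw [G.multiplier_cons A b B h (h b List.mem_cons_self) hB]
    by_cases e : c = b
    · subst e
      rw [proj_self, wcons_head]
    · have hc₂ := (List.mem_cons.mp hc).resolve_left e
      rw [G.proj_of_ne e B hc hc₂, ← Category.assoc, wcons_tail, ih hB]

/-- Multipliers compose to multipliers. -/
theorem multiplier_comp (A B D : List V) (h : ∀ x ∈ B, x ∈ A) (h' : ∀ x ∈ D, x ∈ B)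
    (h'' : ∀ x ∈ D, x ∈ A) :
    G.multiplier A B h ≫ G.multiplier B D h' = G.multiplier A D h'' := by
  induction D with
  | nil => exact hom_unit_ext (C := Cau G) _ _
  | cons c D ih =>
    have hB : ∀ x ∈ D, x ∈ B := fun x hx => h' x (List.mem_cons_of_mem c hx)
    rw [G.multiplier_cons B c D h' (h' c List.mem_cons_self) hB,
      comp_wcons (G.isDet_multiplier A B h),
      G.multiplier_proj A B h c _ (h _ (h' c List.mem_cons_self)),
      ih hB (fun x hx => h x (hB x hx))]
    rfl

theorem multiplier_append (A B D : List V) (h : ∀ x ∈ B ++ D, x ∈ A) (hB : ∀ x ∈ B, x ∈ A)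
    (hD : ∀ x ∈ D, x ∈ A) :
    G.multiplier A (B ++ D) h = wpair (G.multiplier A B hB) (G.multiplier A D hD) := by
  induction B with
  | nil => exact (wpair_nil _ _).symm
  | cons b B ih =>
    have hB' : ∀ x ∈ B, x ∈ A := fun x hx => hB x (List.mem_cons_of_mem b hx)
    have hBD : ∀ x ∈ B ++ D, x ∈ A := fun x hx => h x (List.mem_cons_of_mem b hx)
    rw [G.multiplier_cons A b B hB (hB b List.mem_cons_self) hB', wpair_wcons, ← ih hBD hB']
    rfl

/-- A letter that is not used is discarded. -/
theorem multiplier_cons_left (a : V) (A B : List V) (ha : a ∉ B) (h : ∀ x ∈ B, x ∈ a :: A)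
    (h' : ∀ x ∈ B, x ∈ A) :
    G.multiplier (a :: A) B h = G.tail a A ≫ G.multiplier A B h' := by
  induction B with
  | nil => exact hom_unit_ext (C := Cau G) _ _
  | cons b B ih =>
    rw [List.mem_cons, not_or] at ha
    have hB : ∀ x ∈ B, x ∈ A := fun x hx => h' x (List.mem_cons_of_mem b hx)
    have hB' : ∀ x ∈ B, x ∈ a :: A := fun x hx => h x (List.mem_cons_of_mem b hx)
    rw [G.multiplier_cons (a :: A) b B h (h b List.mem_cons_self) hB',
      G.multiplier_cons A b B h' (h' b List.mem_cons_self) hB, comp_wcons (isDet_tail a A),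
      ih ha.2 hB' hB, G.proj_of_ne (Ne.symm ha.1)]

/-- Singularity is essential: `proj` reads the first occurrence of a letter, so a repeated letter
would have its first wire duplicated and its later wires discarded. -/
theorem multiplier_self (A : List V) (hA : A.Nodup) (h : ∀ x ∈ A, x ∈ A) :
    G.multiplier A A h = 𝟙 (G.obj A) := by
  induction A with
  | nil => exact hom_unit_ext (C := Cau G) _ _
  | cons a A ih =>
    rw [List.nodup_cons] at hA
    rw [G.multiplier_cons (a :: A) a A h List.mem_cons_self (fun x => List.mem_cons_of_mem a),
      G.multiplier_cons_left a A A hA.1 _ (fun _ hx => hx), ih hA.2, Category.comp_id, proj_self,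
      wcons_head_tail]

theorem multiplier_cons_cons (a : V) (A B : List V) (ha : a ∉ B) (h : ∀ x ∈ a :: B, x ∈ a :: A)
    (h' : ∀ x ∈ B, x ∈ A) :
    G.multiplier (a :: A) (a :: B) h =
      wcons (G.head a A) (G.tail a A ≫ G.multiplier A B h') := by
  have hB : ∀ x ∈ B, x ∈ a :: A := fun x hx => List.mem_cons_of_mem a (h' x hx)
  rw [G.multiplier_cons (a :: A) a B h List.mem_cons_self hB, proj_self,
    G.multiplier_cons_left a A B ha hB h']

theorem fst_eq_multiplier (A B : List V) (hAB : (A ++ B).Nodup) (h : ∀ x ∈ A, x ∈ A ++ B) :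
    fst (G.obj A) (G.obj B) = G.multiplier (A ++ B) A h := by
  have hB : ∀ x ∈ B, x ∈ A ++ B := fun x hx => List.mem_append_right A hx
  have := G.multiplier_append (A ++ B) A B (fun x hx => hx) h hB
  rw [G.multiplier_self _ hAB] at this
  exact (Category.id_comp _).symm.trans
    ((congrArg (fun f => f ≫ fst (G.obj A) (G.obj B)) this).trans (pair_fst _ _))

theorem snd_eq_multiplier (A B : List V) (hAB : (A ++ B).Nodup) (h : ∀ x ∈ B, x ∈ A ++ B) :
    snd (G.obj A) (G.obj B) = G.multiplier (A ++ B) B h := by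
  have hA : ∀ x ∈ A, x ∈ A ++ B := fun x hx => List.mem_append_left B hx
  have := G.multiplier_append (A ++ B) A B (fun x hx => hx) hA h
  rw [G.multiplier_self _ hAB] at this
  exact (Category.id_comp _).symm.trans
    ((congrArg (fun f => f ≫ snd (G.obj A) (G.obj B)) this).trans (pair_snd _ _))

/-! ### Single mechanisms -/

/-- Run the mechanism of `i` on duplicates of the wires of its parents, and keep all wires. -/
noncomputable def step (A : List V) (i : V) (h : ∀ j ∈ G.pa i, j ∈ A) :
    G.obj A ⟶ G.obj (i :: A) :=
  wcons (G.multiplier A (G.pa i) h ≫ G.mechanism i) (𝟙 (G.obj A))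

theorem run_cons (t : List V) (i : V) (L : List V) (h : G.IsCausalOrder t (i :: L)) :
    G.run t (i :: L) h = G.run t L h.2 ≫ G.step (L ++ t) i h.1 := by
  have : G.step (L ++ t) i h.1 = Δ[G.obj (L ++ t)] ≫
      (G.multiplier (L ++ t) (G.pa i) h.1 ≫ G.mechanism i) ▷ G.obj (L ++ t) :=
    congrArg (fun f => Δ[G.obj (L ++ t)] ≫ f) (tensorHom_id _ _)
  rw [this]
  rfl

theorem step_multiplier_cons (A : List V) (i : V) (h : ∀ j ∈ G.pa i, j ∈ A) (B : List V)
    (h' : ∀ j ∈ G.pa i, j ∈ B) (hi : i ∉ B) (hB : ∀ x ∈ i :: B, x ∈ i :: A)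
    (hB' : ∀ x ∈ B, x ∈ A) :
    G.step A i h ≫ G.multiplier (i :: A) (i :: B) hB =
      G.multiplier A B hB' ≫ G.step B i h' := by
  rw [G.multiplier_cons_cons i A B hi hB hB', step, wcons_comp_wcons_head_tail, step,
    comp_wcons (G.isDet_multiplier A B hB'), ← Category.assoc,
    G.multiplier_comp A B (G.pa i) hB' h' h, Category.id_comp, Category.comp_id]

/-- The mechanism of `i` only needs a part of the wires. -/
theorem step_multiplier (A : List V) (i : V) (h : ∀ j ∈ G.pa i, j ∈ A) (B : List V)
    (h' : ∀ j ∈ G.pa i, j ∈ B) (hi : i ∉ B) (hB : ∀ x ∈ B, x ∈ A) (D : List V)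
    (hD : ∀ x ∈ D, x ∈ i :: A) (hD' : ∀ x ∈ D, x ∈ i :: B) :
    G.step A i h ≫ G.multiplier (i :: A) D hD =
      G.multiplier A B hB ≫ G.step B i h' ≫ G.multiplier (i :: B) D hD' := by
  have hBA : ∀ x ∈ i :: B, x ∈ i :: A := by
    simpa using fun x hx => Or.inr (hB x hx)
  rw [← G.multiplier_comp (i :: A) (i :: B) D hBA hD' hD, ← Category.assoc,
    G.step_multiplier_cons A i h B h' hi hBA hB, Category.assoc]

/-- A mechanism that depends only on kept wires commutes with the duplication of such wires. -/
theorem step_pair (A : List V) (i : V) (h : ∀ j ∈ G.pa i, j ∈ A) (B : List V) (hi : i ∉ B)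
    (hB : ∀ x ∈ B, x ∈ i :: A) (hB' : ∀ x ∈ B, x ∈ A) :
    G.step A i h ≫ pair (G.multiplier (i :: A) B hB) (𝟙 (G.obj (i :: A))) =
      pair (G.multiplier A B hB') (G.step A i h) := by
  rw [G.multiplier_cons_left i A B hi hB hB']
  exact pair_id_comp_pair_snd_id _ _

/-- Two mechanisms, none of which uses the output of the other, commute. -/
theorem step_step_multiplier (A : List V) (hA : A.Nodup) (i j : V) (hi : i ∉ A) (hj : j ∉ A)
    (hij : i ≠ j) (hpi : ∀ k ∈ G.pa i, k ∈ A) (hpj : ∀ k ∈ G.pa j, k ∈ A)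
    (hpi' : ∀ k ∈ G.pa i, k ∈ j :: A) (hpj' : ∀ k ∈ G.pa j, k ∈ i :: A) (D : List V)
    (hD : ∀ x ∈ D, x ∈ j :: i :: A) (hD' : ∀ x ∈ D, x ∈ i :: j :: A) :
    G.step A i hpi ≫ G.step (i :: A) j hpj' ≫ G.multiplier (j :: i :: A) D hD =
      G.step A j hpj ≫ G.step (j :: A) i hpi' ≫ G.multiplier (i :: j :: A) D hD' := by
  have key : ∀ (i j : V) (hi : i ∉ A) (hpi : ∀ k ∈ G.pa i, k ∈ A) (hpj : ∀ k ∈ G.pa j, k ∈ A)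
      (hpj' : ∀ k ∈ G.pa j, k ∈ i :: A),
      G.step A i hpi ≫ G.step (i :: A) j hpj' =
        wcons (G.multiplier A (G.pa j) hpj ≫ G.mechanism j)
          (wcons (G.multiplier A (G.pa i) hpi ≫ G.mechanism i) (𝟙 (G.obj A))) := by
    intro i j hi hpi hpj hpj'
    have : i ∉ G.pa j := fun h => hi (hpj i h)
    rw [step, step, G.multiplier_cons_left i A (G.pa j) this hpj' hpj, Category.assoc]
    exact pair_id_comp_pair_snd_id _ _
  have hm : ∀ x ∈ i :: j :: A, x ∈ j :: i :: A := by
    intro x hx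
    simp only [List.mem_cons] at hx ⊢
    tauto
  have h₁ : G.multiplier (j :: i :: A) (i :: j :: A) hm =
      wcons (G.tail j (i :: A) ≫ G.head i A)
        (wcons (G.head j (i :: A)) (G.tail j (i :: A) ≫ G.tail i A)) := by
    have hjm : ∀ x ∈ j :: A, x ∈ j :: i :: A := fun x hx => hm x (List.mem_cons_of_mem i hx)
    have hAm : ∀ x ∈ A, x ∈ i :: A := fun x hx => List.mem_cons_of_mem i hx
    rw [G.multiplier_cons _ i (j :: A) hm (hm i List.mem_cons_self) hjm,
      G.multiplier_cons_cons j (i :: A) A hj hjm hAm,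
      G.multiplier_cons_left i A A hi hAm (fun _ hx => hx), G.multiplier_self A hA,
      Category.comp_id, G.proj_of_ne hij _ _ List.mem_cons_self, proj_self]
  rw [← G.multiplier_comp (j :: i :: A) (i :: j :: A) D hm hD' hD, ← Category.assoc,
    ← Category.assoc, ← Category.assoc, key i j hi hpi hpj hpj',
    key j i hj hpj hpi hpi', h₁]
  exact congrArg (fun f => f ≫ G.multiplier (i :: j :: A) D hD')
    (pair_pair_comp_exchange (X := G.obj [j]) (Y := G.obj [i]) (Z := G.obj A) _ _ _)

end CausalGraph

namespace CausalGraph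

open MarkovNotions

variable {V : Type u} (G : CausalGraph V)

/-! ### Sequences of mechanisms -/

theorem run_cons_comp (t : List V) (i : V) (L : List V) (h : G.IsCausalOrder t (i :: L))
    {X : Cau G} (g : G.obj (i :: (L ++ t)) ⟶ X) :
    G.run t (i :: L) h ≫ g = G.run t L h.2 ≫ G.step (L ++ t) i h.1 ≫ g := by
  rw [run_cons, Category.assoc]

theorem IsCausalOrder.mono {t t' : List V} {L : List V} (h : G.IsCausalOrder t L)
    (ht : ∀ x ∈ t, x ∈ t') : G.IsCausalOrder t' L := by
  induction L with
  | nil => trivial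
  | cons i L ih =>
    refine ⟨fun j hj => ?_, ih h.2⟩
    rcases List.mem_append.mp (h.1 j hj) with h' | h'
    · exact List.mem_append_left _ h'
    · exact List.mem_append_right _ (ht j h')

theorem IsCausalOrder.append {t L L' : List V} (h : G.IsCausalOrder t L)
    (h' : G.IsCausalOrder (L ++ t) L') : G.IsCausalOrder t (L' ++ L) := by
  induction L' with
  | nil => exact h
  | cons i L' ih =>
    exact ⟨fun j hj => by simpa using h'.1 j hj, ih h'.2⟩

/-- A sequence of mechanisms only needs a part of the wires. -/
theorem run_multiplier (t t' : List V) (ht : ∀ x ∈ t', x ∈ t) (L : List V)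
    (h : G.IsCausalOrder t L) (h' : G.IsCausalOrder t' L) (hL : L.Nodup) (hLt : L.Disjoint t')
    (D : List V) (hD : ∀ x ∈ D, x ∈ L ++ t) (hD' : ∀ x ∈ D, x ∈ L ++ t') :
    G.run t L h ≫ G.multiplier (L ++ t) D hD =
      G.multiplier t t' ht ≫ G.run t' L h' ≫ G.multiplier (L ++ t') D hD' := by
  induction L generalizing D with
  | nil =>
    refine (Category.id_comp _).trans ((G.multiplier_comp t t' D ht hD' hD).symm.trans ?_)
    exact congrArg (fun f => G.multiplier t t' ht ≫ f) (Category.id_comp _).symm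
  | cons i L ih =>
    rw [List.nodup_cons] at hL
    rw [List.disjoint_cons_left] at hLt
    have hi : i ∉ L ++ t' := by simp [hL.1, hLt.1]
    have hs : ∀ x ∈ L ++ t', x ∈ L ++ t := by
      intro x hx
      rcases List.mem_append.mp hx with h' | h'
      · exact List.mem_append_left _ h'
      · exact List.mem_append_right _ (ht x h')
    -- Since `t'` may repeat letters, the multiplier from `L ++ t'` to itself need not be the
    -- identity. It is inserted here to match the induction hypothesis for the target word `L ++
    -- t'`.
    have hr : G.run t' (i :: L) h' ≫ G.multiplier (i :: L ++ t') D hD' =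
        G.run t' L h'.2 ≫ G.multiplier (L ++ t') (L ++ t') (fun _ hx => hx) ≫
          G.step (L ++ t') i h'.1 ≫ G.multiplier (i :: (L ++ t')) D hD' := by
      rw [← G.step_multiplier (L ++ t') i h'.1 (L ++ t') h'.1 hi (fun _ hx => hx) D hD' hD',
        run_cons]
      exact Category.assoc _ _ _
    rw [hr, run_cons]
    refine (Category.assoc _ _ _).trans ?_
    refine (congrArg (fun f => G.run t L h.2 ≫ f)
      (G.step_multiplier (L ++ t) i h.1 (L ++ t') h'.1 hi hs D hD hD')).trans ?_
    have := ih h.2 h'.2 hL.2 hLt.2 (L ++ t') hs (fun _ hx => hx)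
    rw [← Category.assoc, this]
    simp only [Category.assoc]

/-- Duplication of wires that are present at the start of a sequence of mechanisms. -/
theorem run_pair (t L : List V) (h : G.IsCausalOrder t L) (B : List V) (hLB : L.Disjoint B)
    (hB : ∀ x ∈ B, x ∈ L ++ t) (hB' : ∀ x ∈ B, x ∈ t) :
    G.run t L h ≫ pair (G.multiplier (L ++ t) B hB) (𝟙 (G.obj (L ++ t))) =
      pair (G.multiplier t B hB') (G.run t L h) := by
  induction L with
  | nil => exact Category.id_comp _
  | cons i L ih =>
    rw [List.disjoint_cons_left] at hLB
    have hB₂ : ∀ x ∈ B, x ∈ L ++ t := fun x hx => List.mem_append_right L (hB' x hx)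
    rw [run_cons]
    refine (Category.assoc _ _ _).trans ?_
    refine (congrArg (fun f => G.run t L h.2 ≫ f)
      (G.step_pair (L ++ t) i h.1 B hLB.1 hB hB₂)).trans ?_
    have h₁ : pair (G.multiplier (L ++ t) B hB₂) (G.step (L ++ t) i h.1) =
        pair (G.multiplier (L ++ t) B hB₂) (𝟙 _) ≫ G.obj B ◁ G.step (L ++ t) i h.1 := by
      rw [pair_whiskerLeft, Category.id_comp]
    rw [h₁, ← Category.assoc, ih h.2 hLB.2 hB₂]
    exact pair_whiskerLeft _ _ _

/-- Two sequences of mechanisms in succession. -/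
theorem run_run_multiplier (t L L' : List V) (h : G.IsCausalOrder t L)
    (h' : G.IsCausalOrder (L ++ t) L') (h'' : G.IsCausalOrder t (L' ++ L))
    (hn : (L' ++ L ++ t).Nodup) (D : List V) (hD : ∀ x ∈ D, x ∈ L' ++ (L ++ t))
    (hD' : ∀ x ∈ D, x ∈ L' ++ L ++ t) :
    G.run t L h ≫ G.run (L ++ t) L' h' ≫ G.multiplier (L' ++ (L ++ t)) D hD =
      G.run t (L' ++ L) h'' ≫ G.multiplier (L' ++ L ++ t) D hD' := by
  induction L' generalizing D with
  | nil => exact congrArg (fun f => G.run t L h ≫ f) (Category.id_comp _)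
  | cons i L' ih =>
    have hn' : i ∉ L' ++ L ++ t ∧ (L' ++ L ++ t).Nodup := List.nodup_cons.mp hn
    have hs : ∀ x ∈ L' ++ L ++ t, x ∈ L' ++ (L ++ t) := by simp
    have hr : G.run (L ++ t) (i :: L') h' ≫ G.multiplier (i :: L' ++ (L ++ t)) D hD =
        G.run (L ++ t) L' h'.2 ≫ G.multiplier (L' ++ (L ++ t)) (L' ++ L ++ t) hs ≫
          G.step (L' ++ L ++ t) i h''.1 ≫ G.multiplier (i :: (L' ++ L ++ t)) D hD' := by
      rw [← G.step_multiplier (L' ++ (L ++ t)) i h'.1 (L' ++ L ++ t) h''.1 hn'.1 hs D hD hD',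
        run_cons]
      exact Category.assoc _ _ _
    have := ih h'.2 h''.2 hn'.2 (L' ++ L ++ t) hs (fun _ hx => hx)
    rw [G.multiplier_self _ hn'.2, Category.comp_id] at this
    have hr' : G.run t (i :: L' ++ L) h'' =
        G.run t (L' ++ L) h''.2 ≫ G.step (L' ++ L ++ t) i h''.1 := G.run_cons t i (L' ++ L) h''
    rw [hr, hr', ← this]
    simp only [Category.assoc]
    rfl

/-- A mechanism whose output is not used may be run last. -/
theorem run_append_cons_multiplier (t L₁ L₂ : List V) (i : V)
    (h : G.IsCausalOrder t (L₁ ++ i :: L₂)) (h' : G.IsCausalOrder t (i :: (L₁ ++ L₂)))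
    (hi : ∀ j ∈ G.pa i, j ∈ L₂ ++ t) (hn : (i :: (L₁ ++ L₂ ++ t)).Nodup) (D : List V)
    (hD : ∀ x ∈ D, x ∈ L₁ ++ i :: L₂ ++ t) (hD' : ∀ x ∈ D, x ∈ i :: (L₁ ++ L₂) ++ t) :
    G.run t (L₁ ++ i :: L₂) h ≫ G.multiplier (L₁ ++ i :: L₂ ++ t) D hD =
      G.run t (i :: (L₁ ++ L₂)) h' ≫ G.multiplier (i :: (L₁ ++ L₂) ++ t) D hD' := by
  induction L₁ generalizing D with
  | nil => rfl
  | cons a L₁ ih =>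
    set A := L₁ ++ L₂ ++ t with hA
    have hn' : (i ≠ a ∧ i ∉ A) ∧ a ∉ A ∧ A.Nodup := by
      simpa [hA, not_or] using hn
    obtain ⟨⟨hia, hiA⟩, haA, hAn⟩ := hn'
    have hiA' : ∀ j ∈ G.pa i, j ∈ A := fun j hj => by
      have := hi j hj
      simp only [hA, List.mem_append] at this ⊢
      tauto
    have haA' : ∀ j ∈ G.pa a, j ∈ A := h'.2.1
    have haiA : ∀ j ∈ G.pa a, j ∈ i :: A := fun j hj => List.mem_cons_of_mem i (haA' j hj)
    have hs : ∀ x ∈ i :: A, x ∈ L₁ ++ i :: L₂ ++ t := by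
      intro x hx
      simp only [hA, List.mem_cons, List.mem_append] at hx ⊢
      tauto
    have ha : a ∉ i :: A := by simp [haA, Ne.symm hia]
    have hD₂ : ∀ x ∈ D, x ∈ a :: i :: A := by
      intro x hx
      have := hD x hx
      simp only [hA, List.cons_append, List.mem_cons, List.mem_append] at this ⊢
      tauto
    have h₁ : G.run t (a :: L₁ ++ i :: L₂) h ≫ G.multiplier (a :: L₁ ++ i :: L₂ ++ t) D hD =
        (G.run t (L₁ ++ i :: L₂) h.2 ≫ G.multiplier (L₁ ++ i :: L₂ ++ t) (i :: A) hs) ≫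
          G.step (i :: A) a haiA ≫ G.multiplier (a :: i :: A) D hD₂ := by
      rw [Category.assoc, ← G.step_multiplier (L₁ ++ i :: L₂ ++ t) a h.1 (i :: A) haiA ha hs D hD
        hD₂]
      exact G.run_cons_comp t a (L₁ ++ i :: L₂) h _
    have h₂ : G.run t (i :: (a :: L₁ ++ L₂)) h' ≫
        G.multiplier (i :: (a :: L₁ ++ L₂) ++ t) D hD' =
        G.run t (L₁ ++ L₂) h'.2.2 ≫ G.step A a haA' ≫ G.step (a :: A) i h'.1 ≫
          G.multiplier (i :: a :: A) D hD' := by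
      have e : G.run t (i :: (a :: L₁ ++ L₂)) h' =
        (G.run t (L₁ ++ L₂) h'.2.2 ≫ G.step A a haA') ≫ G.step (a :: A) i h'.1 :=
        (G.run_cons t i _ h').trans
          (congrArg (fun f => f ≫ G.step (a :: A) i h'.1) (G.run_cons t a _ h'.2))
      rw [e]
      exact (Category.assoc _ _ _).trans (Category.assoc _ _ _)
    have hiA₂ : G.IsCausalOrder t (i :: (L₁ ++ L₂)) := ⟨hiA', h'.2.2⟩
    have hn₂ : (i :: A).Nodup := List.nodup_cons.mpr ⟨hiA, hAn⟩
    -- The induction hypothesis moves `i` past `L₁`; it then remains to exchange the two adjacent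
    -- mechanisms of `i` and `a`.
    have h₃ : G.run t (L₁ ++ i :: L₂) h.2 ≫ G.multiplier (L₁ ++ i :: L₂ ++ t) (i :: A) hs =
        G.run t (L₁ ++ L₂) h'.2.2 ≫ G.step A i hiA' := by
      rw [ih h.2 hiA₂ hn₂ (i :: A) hs (fun _ hx => hx)]
      have e : G.multiplier (i :: (L₁ ++ L₂) ++ t) (i :: A) (fun _ hx => hx) = 𝟙 _ :=
        G.multiplier_self (i :: A) hn₂ _
      rw [e, run_cons]
      exact Category.comp_id _
    rw [h₁, h₂, h₃, Category.assoc,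
      G.step_step_multiplier A hAn i a hiA haA hia hiA' haA' h'.1 haiA D hD₂ hD']

/-- The order in which the mechanisms are run does not matter. -/
theorem run_perm_multiplier (t L L' : List V) (h : G.IsCausalOrder t L)
    (h' : G.IsCausalOrder t L') (hp : L.Perm L') (hn : (L' ++ t).Nodup) (D : List V)
    (hD : ∀ x ∈ D, x ∈ L ++ t) (hD' : ∀ x ∈ D, x ∈ L' ++ t) :
    G.run t L h ≫ G.multiplier (L ++ t) D hD = G.run t L' h' ≫ G.multiplier (L' ++ t) D hD' := by
  induction L' generalizing L D with
  | nil =>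
    obtain rfl := hp.eq_nil
    rfl
  | cons i L' ih =>
    obtain ⟨L₁, L₂, rfl⟩ := List.append_of_mem (hp.mem_iff.mpr List.mem_cons_self)
    have hp' : (L₁ ++ L₂).Perm L' := (List.perm_middle.symm.trans hp).cons_inv
    have hn' : i ∉ L' ++ t ∧ (L' ++ t).Nodup := List.nodup_cons.mp hn
    -- In the order `i :: L'` all of `L'` runs before `i`, so no vertex of `L'` has `i` as a parent.
    -- Hence `i` may be delayed to the end in the other order too.
    have hnot : ∀ a ∈ L', i ∉ G.pa a := by
      have : ∀ M : List V, (∀ x ∈ M, x ∈ L') → G.IsCausalOrder t M → ∀ a ∈ M, i ∉ G.pa a := by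
        intro M hM hc
        induction M with
        | nil => simp
        | cons b M ihM =>
          intro a ha
          rcases List.mem_cons.mp ha with rfl | ha
          · intro hia
            apply hn'.1
            rcases List.mem_append.mp (hc.1 i hia) with h₁ | h₁
            · exact List.mem_append_left _ (hM i (List.mem_cons_of_mem _ h₁))
            · exact List.mem_append_right _ h₁
          · exact ihM (fun x hx => hM x (List.mem_cons_of_mem _ hx)) hc.2 a ha
      exact this L' (fun _ hx => hx) h'.2
    have hrem : ∀ M : List V, (∀ a ∈ M, i ∉ G.pa a) → G.IsCausalOrder t (M ++ i :: L₂) →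
        G.IsCausalOrder t (M ++ L₂) ∧ ∀ j ∈ G.pa i, j ∈ L₂ ++ t := by
      intro M hM hc
      induction M with
      | nil => exact ⟨hc.2, hc.1⟩
      | cons b M ihM =>
        obtain ⟨h₁, h₂⟩ := ihM (fun a ha => hM a (List.mem_cons_of_mem _ ha)) hc.2
        refine ⟨⟨fun j hj => ?_, h₁⟩, h₂⟩
        have hji : j ≠ i := fun e => hM b List.mem_cons_self (e ▸ hj)
        have : j ∈ M ++ i :: L₂ ++ t := hc.1 j hj
        change j ∈ M ++ L₂ ++ t
        simp only [List.mem_append, List.mem_cons] at this ⊢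
        tauto
    obtain ⟨hc, hi⟩ := hrem L₁
      (fun a ha => hnot a (hp'.mem_iff.mp (List.mem_append_left _ ha))) h
    have hiA : ∀ j ∈ G.pa i, j ∈ L₁ ++ L₂ ++ t := fun j hj => by
      have := hi j hj
      simp only [List.mem_append] at this ⊢
      tauto
    have hnp : (i :: (L₁ ++ L₂ ++ t)).Nodup :=
      (((hp'.append_right t).cons i).nodup_iff).mpr hn
    have hD₂ : ∀ x ∈ D, x ∈ i :: (L₁ ++ L₂) ++ t := by
      intro x hx
      have := hD x hx
      simp only [List.cons_append, List.mem_cons, List.mem_append] at this ⊢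
      tauto
    have hs : ∀ x ∈ L' ++ t, x ∈ L₁ ++ L₂ ++ t := fun x hx =>
      (hp'.append_right t).mem_iff.mpr hx
    rw [G.run_append_cons_multiplier t L₁ L₂ i h ⟨hiA, hc⟩ hi hnp D hD hD₂]
    refine (G.run_cons_comp t i (L₁ ++ L₂) ⟨hiA, hc⟩ _).trans
      (Eq.trans ?_ (G.run_cons_comp t i L' h' _).symm)
    refine (congrArg (fun f => G.run t (L₁ ++ L₂) hc ≫ f)
      (G.step_multiplier (L₁ ++ L₂ ++ t) i hiA (L' ++ t) h'.1 hn'.1 hs D hD₂ hD')).trans ?_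
    have e := ih (L₁ ++ L₂) hc h'.2 hp' hn'.2 (L' ++ t) hs (fun _ hx => hx)
    rw [G.multiplier_self _ hn'.2, Category.comp_id] at e
    rw [← Category.assoc, e]
    rfl

end CausalGraph

namespace CausalGraph

variable {V : Type u} (G : CausalGraph V)

/-! ### Directed paths and separation -/

theorem IsDirectedPath.exists_drop {i j : V} {p : List V} (h : G.IsDirectedPath i j p) {x : V}
    (hx : x ∈ p) : ∃ q, G.IsDirectedPath x j q ∧ (∀ y ∈ q, y ∈ p) ∧
      (x ≠ i → q.length < p.length) := by
  obtain ⟨s, r, rfl⟩ := List.append_of_mem hx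
  refine ⟨x :: r, ⟨h.1.right_of_append, rfl, ?_⟩, fun y => List.mem_append_right s, fun hxi => ?_⟩
  · simpa using h.2.2
  · cases s with
    | nil => exact absurd (by simpa using h.2.1) hxi
    | cons a s => simp

theorem IsDirectedPath.exists_take {i j : V} {p : List V} (h : G.IsDirectedPath i j p) {x : V}
    (hx : x ∈ p) : ∃ q, G.IsDirectedPath i x q ∧ (∀ y ∈ q, y ∈ p) ∧
      (x ≠ j → q.length < p.length) := by
  obtain ⟨s, r, rfl⟩ := List.append_of_mem hx
  have hs : s ++ x :: r = (s ++ [x]) ++ r := by simp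
  refine ⟨s ++ [x], ⟨?_, ?_, by simp⟩, ?_, fun hxj => ?_⟩
  · have := h.1
    rw [hs] at this
    exact this.left_of_append
  · have := h.2.1
    cases s <;> simpa using this
  · intro y hy
    rw [hs]
    exact List.mem_append_left _ hy
  · cases r with
    | nil => exact absurd (by simpa using h.2.2) hxj
    | cons a r => simp

theorem IsDirectedPath.head_mem {i j : V} {p : List V} (h : G.IsDirectedPath i j p) : i ∈ p :=
  List.mem_of_head? h.2.1

theorem IsDirectedPath.last_mem {i j : V} {p : List V} (h : G.IsDirectedPath i j p) : j ∈ p :=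
  List.mem_of_getLast? h.2.2

/-- Every directed path between two sets contains one that meets them only in its ends. -/
theorem exists_proper_path {X Y : Set V} {i j : V} {p : List V} (h : G.IsDirectedPath i j p)
    (hi : i ∈ X) (hj : j ∈ Y) :
    ∃ i' ∈ X, ∃ j' ∈ Y, ∃ q, G.IsDirectedPath i' j' q ∧ (∀ y ∈ q, y ∈ p) ∧
      ∀ y ∈ q, y ∈ X ∨ y ∈ Y → y = i' ∨ y = j' := by
  induction hn : p.length using Nat.strong_induction_on generalizing i j p with
  | _ n ih =>
    subst hn
    by_cases hp : ∀ y ∈ p, y ∈ X ∨ y ∈ Y → y = i ∨ y = j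
    · exact ⟨i, hi, j, hj, p, h, fun _ hy => hy, hp⟩
    · push Not at hp
      obtain ⟨y, hy, hXY, hyi, hyj⟩ := hp
      rcases hXY with hX | hY
      · obtain ⟨q, hq, hqp, hlt⟩ := IsDirectedPath.exists_drop G h hy
        obtain ⟨i', hi', j', hj', r, hr, hrq, hr'⟩ := ih _ (hlt hyi) hq hX hj rfl
        exact ⟨i', hi', j', hj', r, hr, fun z hz => hqp z (hrq z hz), hr'⟩
      · obtain ⟨q, hq, hqp, hlt⟩ := IsDirectedPath.exists_take G h hy
        obtain ⟨i', hi', j', hj', r, hr, hrq, hr'⟩ := ih _ (hlt hyj) hq hi hY rfl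
        exact ⟨i', hi', j', hj', r, hr, fun z hz => hqp z (hrq z hz), hr'⟩

theorem ForwardTSeparated.exists_mem {X Y Z : Set V} (h : G.ForwardTSeparated X Y Z)
    (hXY : Disjoint X Y) {i j : V} {p : List V} (hp : G.IsDirectedPath i j p) (hi : i ∈ X)
    (hj : j ∈ Y) : ∃ k ∈ Z, k ∈ p := by
  obtain ⟨i', hi', j', hj', q, hq, hqp, hq'⟩ := G.exists_proper_path hp hi hj
  obtain ⟨k, hk, hkq⟩ := h i' j' {x | x ∈ q} ⟨hXY.ne_of_mem hi' hj', q, hq, rfl⟩ ⟨hi', hj', hq'⟩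
  exact ⟨k, hk, hqp k hkq⟩

theorem BackwardTSeparated.exists_mem_path {X Y Z : Set V} (h : G.BackwardTSeparated X Y Z)
    (hXY : Disjoint X Y) {i j : V} {p : List V} (hp : G.IsDirectedPath j i p) (hi : i ∈ X)
    (hj : j ∈ Y) : ∃ k ∈ Z, k ∈ p := by
  obtain ⟨j', hj', i', hi', q, hq, hqp, hq'⟩ := G.exists_proper_path hp hj hi
  obtain ⟨k, hk, hkq⟩ := h i' j' {x | x ∈ q} ⟨hXY.ne_of_mem hi' hj', Or.inl ⟨q, hq, rfl⟩⟩
    ⟨hi', hj', fun x hx hx' => (hq' x hx hx'.symm).symm⟩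
  exact ⟨k, hk, hqp k hkq⟩

/-- A pair of directed paths from a common vertex to two backward separated sets meets the
separating set, provided that the path to the second set avoids the first set. -/
theorem BackwardTSeparated.exists_mem {X Y Z : Set V} (h : G.BackwardTSeparated X Y Z)
    (hXY : Disjoint X Y) {k i j : V} {p q : List V} (hp : G.IsDirectedPath k i p)
    (hq : G.IsDirectedPath k j q) (hi : i ∈ X) (hj : j ∈ Y) (hqX : ∀ x ∈ q, x ∉ X) :
    ∃ z ∈ Z, z ∈ p ∨ z ∈ q := by
  -- A vertex of `Y` on `p` gives a directed path from `Y` to `X`. Every other failure to be a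
  -- proper backward trek shortens one of the paths: a second vertex of `X` on `p` or of `Y` on `q`,
  -- or a common vertex besides `k`. A vertex of `X` on `q` would give a forward trek, which
  -- backward separation does not control; this is why `hqX` is assumed.
  induction hn : p.length + q.length using Nat.strong_induction_on generalizing k i j p q with
  | _ n ih =>
    subst hn
    by_cases h₁ : ∃ y ∈ p, y ∈ Y
    · obtain ⟨y, hy, hyY⟩ := h₁
      obtain ⟨r, hr, hrp, -⟩ := IsDirectedPath.exists_drop G hp hy
      obtain ⟨z, hz, hzr⟩ := BackwardTSeparated.exists_mem_path G h hXY hr hi hyY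
      exact ⟨z, hz, Or.inl (hrp z hzr)⟩
    by_cases h₂ : ∃ y ∈ p, y ∈ X ∧ y ≠ i
    · obtain ⟨y, hy, hyX, hyi⟩ := h₂
      obtain ⟨r, hr, hrp, hlt⟩ := IsDirectedPath.exists_take G hp hy
      obtain ⟨z, hz, hzr⟩ := ih _ (Nat.add_lt_add_right (hlt hyi) _) hr hq hyX hj hqX rfl
      exact ⟨z, hz, hzr.imp_left (hrp z)⟩
    by_cases h₃ : ∃ y ∈ q, y ∈ Y ∧ y ≠ j
    · obtain ⟨y, hy, hyY, hyj⟩ := h₃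
      obtain ⟨r, hr, hrq, hlt⟩ := IsDirectedPath.exists_take G hq hy
      obtain ⟨z, hz, hzr⟩ := ih _ (Nat.add_lt_add_left (hlt hyj) _) hp hr hi hyY
        (fun x hx => hqX x (hrq x hx)) rfl
      exact ⟨z, hz, hzr.imp_right (hrq z)⟩
    by_cases h₄ : ∃ y ∈ p, y ∈ q ∧ y ≠ k
    · obtain ⟨y, hyp, hyq, hyk⟩ := h₄
      obtain ⟨r, hr, hrp, hlt⟩ := IsDirectedPath.exists_drop G hp hyp
      obtain ⟨s, hs, hsq, hlt'⟩ := IsDirectedPath.exists_drop G hq hyq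
      obtain ⟨z, hz, hzr⟩ := ih _ (Nat.add_lt_add (hlt hyk) (hlt' hyk)) hr hs hi hj
        (fun x hx => hqX x (hsq x hx)) rfl
      exact ⟨z, hz, hzr.imp (hrp z) (hsq z)⟩
    push Not at h₁ h₂ h₃ h₄
    have hki : k ≠ i := fun e => hqX k hq.head_mem (e ▸ hi)
    have hkj : k ≠ j := fun e => h₁ k hp.head_mem (e ▸ hj)
    obtain ⟨z, hz, hzT⟩ := h i j {x | x ∈ p ∨ x ∈ q}
      ⟨hXY.ne_of_mem hi hj, Or.inr ⟨k, p, q, hki, hkj, hp, hq, h₄, rfl⟩⟩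
      ⟨hi, hj, by
        rintro x (hx | hx) (hx' | hx')
        · exact Or.inl (h₂ x hx hx')
        · exact absurd hx' (h₁ x hx)
        · exact absurd hx' (hqX x hx)
        · exact Or.inr (h₃ x hx hx')⟩
    exact ⟨z, hz, hzT⟩

/-! ### The vertices of causal effects -/

section Effect

variable [Finite V]

theorem nodup_order : G.order.Nodup := G.exists_causalOrder.choose_spec.1

theorem nodup_effectOrder (t v : List V) : (G.effectOrder t v).Nodup :=
  G.nodup_order.filter _

/-- The path in `effectVertices` may start in `t`; excluding `t` from the mechanisms makes the whole
path, start included, avoid `t`. -/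
theorem mem_effectOrder {t v : List V} {i : V} : i ∈ G.effectOrder t v ↔
    ∃ j ∈ v, ∃ p, G.IsDirectedPath i j p ∧ ∀ x ∈ p, x ∉ t := by
  classical
  have h : i ∈ G.effectOrder t v ↔ i ∈ G.effectVertices t v ∧ i ∉ t := by
    simp [effectOrder, G.mem_order i]
  rw [h]
  constructor
  · rintro ⟨h | ⟨j, hj, p, hp, hpt⟩, hi⟩
    · exact absurd h hi
    · refine ⟨j, hj, p, hp, ?_⟩
      obtain ⟨_, hp', _⟩ := hp
      cases p with
      | nil => simp at hp'
      | cons a p =>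
        obtain rfl : a = i := by simpa using hp'
        simpa using ⟨hi, hpt⟩
  · rintro ⟨j, hj, p, hp, hpt⟩
    exact ⟨Or.inr ⟨j, hj, p, hp, fun x hx => hpt x (List.mem_of_mem_tail hx)⟩,
      hpt i hp.head_mem⟩

theorem disjoint_effectOrder (t v : List V) : (G.effectOrder t v).Disjoint t := by
  intro i hi
  obtain ⟨j, -, p, hp, hpt⟩ := G.mem_effectOrder.mp hi
  exact hpt i hp.head_mem

/-- A path that avoids `u` and meets `v` is cut at a vertex of `v`; one that avoids `v` must end in
`w`. No separation is needed, but the two alternatives can overlap. -/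
theorem mem_effectOrder_append_right {u v w : List V} {i : V} :
    i ∈ G.effectOrder u (v ++ w) ↔ i ∈ G.effectOrder (u ++ v) w ∨ i ∈ G.effectOrder u v := by
  simp only [mem_effectOrder]
  constructor
  · rintro ⟨j, hj, p, hp, hpu⟩
    by_cases h : ∃ x ∈ p, x ∈ v
    · obtain ⟨x, hx, hxv⟩ := h
      obtain ⟨q, hq, hqp, -⟩ := IsDirectedPath.exists_take G hp hx
      exact Or.inr ⟨x, hxv, q, hq, fun y hy => hpu y (hqp y hy)⟩
    · push Not at h
      refine Or.inl ⟨j, ?_, p, hp, fun x hx => ?_⟩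
      · exact (List.mem_append.mp hj).resolve_left (h j hp.last_mem)
      · simpa using ⟨hpu x hx, h x hx⟩
  · rintro (⟨j, hj, p, hp, hpu⟩ | ⟨j, hj, p, hp, hpu⟩)
    · exact ⟨j, List.mem_append_right v hj, p, hp,
        fun x hx hxu => hpu x hx (List.mem_append_left v hxu)⟩
    · exact ⟨j, List.mem_append_left w hj, p, hp, hpu⟩

/-- A common vertex would start paths to `v` and to `w` that avoid `u`, the latter avoiding `v` as
well, contrary to `BackwardTSeparated.exists_mem`. -/
theorem BackwardTSeparated.disjoint_effectOrder {u v w : List V}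
    (h : G.BackwardTSeparated {x | x ∈ v} {x | x ∈ w} {x | x ∈ u}) (hvw : v.Disjoint w) :
    (G.effectOrder (u ++ v) w).Disjoint (G.effectOrder u v) := by
  intro k hkw hkv
  obtain ⟨j, hj, q, hq, hqu⟩ := G.mem_effectOrder.mp hkw
  obtain ⟨i, hi, p, hp, hpu⟩ := G.mem_effectOrder.mp hkv
  simp only [List.mem_append, not_or] at hqu
  obtain ⟨z, hz, hz'⟩ := BackwardTSeparated.exists_mem G h
    (Set.disjoint_left.mpr fun _ hx hx' => hvw hx hx') hp hq hi hj fun x hx => (hqu x hx).2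
  rcases hz' with hz' | hz'
  · exact hpu z hz' hz
  · exact (hqu z hz').1 hz

/-- If a path to `w` avoiding `u` met `v`, its end piece would lead from `v` to `w` without meeting
`u`. The lists agree, not only their members, because both filter the same order. -/
theorem ForwardTSeparated.effectOrder_eq {u v w : List V}
    (h : G.ForwardTSeparated {x | x ∈ v} {x | x ∈ w} {x | x ∈ u}) (hvw : v.Disjoint w) :
    G.effectOrder (u ++ v) w = G.effectOrder u w := by
  have hmem : ∀ i, i ∈ G.effectOrder (u ++ v) w ↔ i ∈ G.effectOrder u w := by
    intro i
    simp only [mem_effectOrder]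
    constructor
    · rintro ⟨j, hj, p, hp, hpu⟩
      exact ⟨j, hj, p, hp, fun x hx hxu => hpu x hx (List.mem_append_left v hxu)⟩
    · rintro ⟨j, hj, p, hp, hpu⟩
      refine ⟨j, hj, p, hp, fun x hx hxuv => ?_⟩
      rcases List.mem_append.mp hxuv with hxu | hxv
      · exact hpu x hx hxu
      · obtain ⟨q, hq, hqp, -⟩ := IsDirectedPath.exists_drop G hp hx
        obtain ⟨z, hz, hzq⟩ := ForwardTSeparated.exists_mem G h
          (Set.disjoint_left.mpr fun _ hx hx' => hvw hx hx') hq hxv hj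
        exact hpu z (hqp z hzq) hz
  classical
  rw [effectOrder, effectOrder]
  refine List.filter_congr fun i hi => ?_
  have := hmem i
  simp only [effectOrder, List.mem_filter, hi, true_and] at this
  exact Bool.eq_iff_iff.mpr this

end Effect

end CausalGraph

namespace CausalGraph

open MarkovNotions

variable {V : Type u} (G : CausalGraph V) [Finite V]

/-! ### Separation and causal effects in the causal theory -/

/-- If `v` is backward separated from `w`, the causal effect on `v` and `w` disintegrates. -/
theorem BackwardTSeparated.effect_append {u v w : List V} (hu : u.Nodup)
    (hvw : v.Disjoint w) (h : G.BackwardTSeparated {x | x ∈ v} {x | x ∈ w} {x | x ∈ u}) :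
    (G.effect u (v ++ w) : G.obj u ⟶ G.obj v ⊗ G.obj w) =
      disintegrate (G.effect u v)
        ((β_ (G.obj v) (G.obj u)).hom ≫ (G.effect (u ++ v) w : G.obj u ⊗ G.obj v ⟶ G.obj w)) := by
  set LA := G.effectOrder u v with hLA
  set LB := G.effectOrder (u ++ v) w with hLB
  have hA : G.IsCausalOrder u LA := G.isCausalOrder_effectOrder u v
  have hB : G.IsCausalOrder (u ++ v) LB := G.isCausalOrder_effectOrder (u ++ v) w
  have hvA : ∀ x ∈ v, x ∈ LA ++ u := G.mem_effectOrder_append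
  have huA : ∀ x ∈ u, x ∈ LA ++ u := fun x hx => List.mem_append_right LA hx
  have huvA : ∀ x ∈ u ++ v, x ∈ LA ++ u := fun x hx =>
    (List.mem_append.mp hx).elim (huA x) (hvA x)
  have hB' : G.IsCausalOrder (LA ++ u) LB := IsCausalOrder.mono G hB huvA
  have hBA : G.IsCausalOrder u (LB ++ LA) := IsCausalOrder.append G hA hB'
  have hAu : LA.Disjoint u := G.disjoint_effectOrder u v
  have hBuv : LB.Disjoint (u ++ v) := G.disjoint_effectOrder (u ++ v) w
  have hBv : LB.Disjoint v := (List.disjoint_append_right.mp hBuv).2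
  have hBu : LB.Disjoint u := (List.disjoint_append_right.mp hBuv).1
  -- This is the only place where separation enters.
  have hdisj : LB.Disjoint LA := BackwardTSeparated.disjoint_effectOrder G h hvw
  have hnA : LA.Nodup := G.nodup_effectOrder u v
  have hnB : LB.Nodup := G.nodup_effectOrder (u ++ v) w
  have hnBA : (LB ++ LA).Nodup := hnB.append hnA hdisj
  have hn : (LB ++ LA ++ u).Nodup :=
    hnBA.append hu (List.disjoint_append_left.mpr ⟨hBu, hAu⟩)
  have hp : (G.effectOrder u (v ++ w)).Perm (LB ++ LA) :=
    (List.perm_ext_iff_of_nodup (G.nodup_effectOrder _ _) hnBA).mpr fun i => by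
      rw [G.mem_effectOrder_append_right, List.mem_append]
  have hwB : ∀ x ∈ w, x ∈ LB ++ (LA ++ u) := fun x hx => by
    have := G.mem_effectOrder_append (t := u ++ v) x hx
    rcases List.mem_append.mp this with h₁ | h₁
    · exact List.mem_append_left _ h₁
    · exact List.mem_append_right _ (huvA x h₁)
  have hvB : ∀ x ∈ v, x ∈ LB ++ (LA ++ u) := fun x hx => List.mem_append_right _ (hvA x hx)
  have hvwB : ∀ x ∈ v ++ w, x ∈ LB ++ (LA ++ u) := fun x hx =>
    (List.mem_append.mp hx).elim (hvB x) (hwB x)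
  have hvwB' : ∀ x ∈ v ++ w, x ∈ LB ++ LA ++ u := fun x hx => by
    simpa using hvwB x hx
  set r := G.run u LA hA with hr
  set mv := G.multiplier (LA ++ u) v hvA with hmv
  set mu := G.multiplier (LA ++ u) u huA with hmu
  set g := (β_ (G.obj v) (G.obj u)).hom ≫
    (G.effect (u ++ v) w : G.obj u ⊗ G.obj v ⟶ G.obj w) with hg
  have e₁ : G.effect u (v ++ w) = r ≫ G.run (LA ++ u) LB hB' ≫
      G.multiplier (LB ++ (LA ++ u)) (v ++ w) hvwB := by
    rw [G.run_run_multiplier u LA LB hA hB' hBA hn (v ++ w) hvwB hvwB',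
      ← G.run_perm_multiplier u _ _ (G.isCausalOrder_effectOrder u (v ++ w)) hBA hp hn (v ++ w)
        G.mem_effectOrder_append hvwB', effect]
  -- The second block reads nothing but the wires of `u` and `v`, so it may be run on copies of
  -- these alone.
  have e₂ : G.run (LA ++ u) LB hB' ≫ G.multiplier (LB ++ (LA ++ u)) w hwB = pair mv mu ≫ g := by
    have h₁ : G.multiplier (LA ++ u) (u ++ v) huvA = pair mv mu ≫ (β_ (G.obj v) (G.obj u)).hom :=
      (G.multiplier_append _ u v huvA huA hvA).trans (pair_braiding _ _).symm
    rw [G.run_multiplier (LA ++ u) (u ++ v) huvA LB hB' hB hnB hBuv w hwB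
      G.mem_effectOrder_append, hg]
    exact (congrArg (fun f => f ≫ G.effect (u ++ v) w) h₁).trans (Category.assoc _ _ _)
  -- The second block leaves the wires of `v` untouched, so the output `v` can be copied off before
  -- it runs.
  have e₃ : G.run (LA ++ u) LB hB' ≫ G.multiplier (LB ++ (LA ++ u)) (v ++ w) hvwB =
      pair mv (pair mv mu ≫ g) := by
    have h₁ : G.multiplier (LB ++ (LA ++ u)) (v ++ w) hvwB =
        pair (G.multiplier (LB ++ (LA ++ u)) v hvB) (𝟙 _) ≫
          G.obj v ◁ G.multiplier (LB ++ (LA ++ u)) w hwB := by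
      rw [pair_whiskerLeft, Category.id_comp]
      exact G.multiplier_append _ v w hvwB hvB hwB
    rw [← e₂, h₁]
    refine (Category.assoc _ _ _).symm.trans ?_
    rw [G.run_pair (LA ++ u) LB hB' v hBv hvB hvA, pair_whiskerLeft]
  -- The first block keeps its input, so the second copy of `u` in the disintegration can be read
  -- off afterwards.
  have e₄ : pair r (𝟙 (G.obj u)) = r ≫ pair (𝟙 _) mu := by
    have h₁ := G.run_pair u LA hA u hAu huA (fun _ hx => hx)
    rw [G.multiplier_self u hu] at h₁
    rw [← pair_braiding, ← h₁, Category.assoc, pair_braiding]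
  have e₅ : disintegrate (G.effect u v) g = r ≫ pair mv (pair mv mu ≫ g) := by
    have h₁ : pair (G.effect u v ≫ pair (𝟙 _) (𝟙 _)) (𝟙 (G.obj u)) =
        pair r (𝟙 (G.obj u)) ≫ pair mv mv ▷ G.obj u := by
      rw [pair_whiskerRight]
      have : mv ≫ pair (𝟙 _) (𝟙 _) = pair mv mv := G.isDet_multiplier _ _ _
      rw [← this, ← Category.assoc]
      rfl
    rw [disintegrate_eq, h₁, e₄]
    simp only [Category.assoc]
    rw [← Category.assoc (pair _ _), pair_whiskerRight, Category.id_comp,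
      ← Category.assoc (pair _ _), pair_associator, pair_whiskerLeft]
  rw [e₅, ← e₃]
  exact e₁

/-- If `v` is forward separated from `w`, an intervention on `v` is irrelevant to `w`. -/
theorem ForwardTSeparated.braiding_effect {u v w : List V} (hu : u.Nodup) (hv : v.Nodup)
    (huv : u.Disjoint v) (hvw : v.Disjoint w)
    (h : G.ForwardTSeparated {x | x ∈ v} {x | x ∈ w} {x | x ∈ u}) :
    (β_ (G.obj v) (G.obj u)).hom ≫ (G.effect (u ++ v) w : G.obj u ⊗ G.obj v ⟶ G.obj w) =
      ignoreFst (G.obj v) (G.effect u w) := by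
  have hn : (v ++ u).Nodup := hv.append hu huv.symm
  have hu' : ∀ x ∈ u, x ∈ v ++ u := fun x hx => List.mem_append_right v hx
  have hv' : ∀ x ∈ v, x ∈ v ++ u := fun x hx => List.mem_append_left u hx
  have huv' : ∀ x ∈ u ++ v, x ∈ v ++ u := fun x hx =>
    (List.mem_append.mp hx).elim (hu' x) (hv' x)
  have hβ : (β_ (G.obj v) (G.obj u)).hom = G.multiplier (v ++ u) (u ++ v) huv' := by
    rw [braiding_eq_pair, G.fst_eq_multiplier v u hn hv', G.snd_eq_multiplier v u hn hu',
      G.multiplier_append (v ++ u) u v huv' hu' hv']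
    rfl
  -- The lists of mechanisms occur in the types of the runs, so their equality is substituted for
  -- variables. Both sides then equal the run of `L` on all the wires `v ++ u`, followed by the
  -- multiplier to `w`.
  have key : ∀ L L' : List V, L' = L → L.Nodup → L.Disjoint (u ++ v) →
      ∀ (hc : G.IsCausalOrder u L) (hc' : G.IsCausalOrder (u ++ v) L')
        (hm : ∀ x ∈ w, x ∈ L ++ u) (hm' : ∀ x ∈ w, x ∈ L' ++ (u ++ v)),
      G.multiplier (v ++ u) (u ++ v) huv' ≫ G.run (u ++ v) L' hc' ≫
          G.multiplier (L' ++ (u ++ v)) w hm' =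
        G.multiplier (v ++ u) u hu' ≫ G.run u L hc ≫ G.multiplier (L ++ u) w hm := by
    rintro _ L rfl hL hLuv hc hc' hm hm'
    have hc₂ : G.IsCausalOrder (v ++ u) L := IsCausalOrder.mono G hc hu'
    have hm₂ : ∀ x ∈ w, x ∈ L ++ (v ++ u) := fun x hx =>
      (List.mem_append.mp (hm x hx)).elim (List.mem_append_left _)
        fun h₁ => List.mem_append_right L (hu' x h₁)
    rw [← G.run_multiplier (v ++ u) (u ++ v) huv' L hc₂ hc' hL hLuv w hm₂ hm',
      ← G.run_multiplier (v ++ u) u hu' L hc₂ hc hL (List.disjoint_append_right.mp hLuv).1 w hm₂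
        hm]
  have e := ForwardTSeparated.effectOrder_eq G h hvw
  rw [ignoreFst_eq, hβ, G.snd_eq_multiplier v u hn hu']
  exact key _ _ e (G.nodup_effectOrder u w) (e ▸ G.disjoint_effectOrder (u ++ v) w) _ _ _ _

end CausalGraph

/-! ### Strong Markov functors -/

namespace MarkovNotions

open Functor.LaxMonoidal Functor.OplaxMonoidal

variable {C D : Type*} [Category C] [MonoidalCategory C] [MarkovCategory C]
  [Category D] [MonoidalCategory D] [MarkovCategory D] (F : C ⥤ D) [F.Braided]
  [IsMarkovFunctor F] {X Y Z : C}

/-- Strong Markov functors preserve disintegrations. -/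
theorem map_disintegrate (h : Z ⟶ X) (g : X ⊗ Z ⟶ Y) :
    F.map (disintegrate h g) ≫ δ F X Y = disintegrate (F.map h) (μ F X Z ≫ F.map g) := by
  have h₁ : F.map (X ◁ g) ≫ δ F X Y = δ F X (X ⊗ Z) ≫ F.obj X ◁ F.map g :=
    (δ_natural_right F X g).symm
  have h₂ : F.obj X ◁ F.map g = F.obj X ◁ δ F X Z ≫ F.obj X ◁ (μ F X Z ≫ F.map g) := by
    rw [← MonoidalCategory.whiskerLeft_comp, Functor.Monoidal.δ_μ_assoc]
  have h₃ : F.map ((h ≫ Δ[X]) ▷ Z) ≫ δ F (X ⊗ X) Z = δ F Z Z ≫ F.map (h ≫ Δ[X]) ▷ F.obj Z :=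
    (δ_natural_left F (h ≫ Δ[X]) Z).symm
  have h₄ : F.map Δ[X] ≫ δ F X X = Δ[F.obj X] := IsMarkovFunctor.map_copy X
  have h₅ : F.map Δ[Z] ≫ δ F Z Z = Δ[F.obj Z] := IsMarkovFunctor.map_copy Z
  have h₆ := Functor.OplaxMonoidal.associativity F X X Z
  simp only [disintegrate, Functor.map_comp, Category.assoc] at *
  rw [h₁, h₂, ← reassoc_of% h₆, reassoc_of% h₃, reassoc_of% h₅, ← h₄]
  simp only [MonoidalCategory.comp_whiskerRight, Category.assoc]

/-- Strong Markov functors preserve discarded inputs. -/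
theorem map_ignoreFst (X : C) (g : Z ⟶ Y) :
    μ F X Z ≫ F.map (ignoreFst X g) = ignoreFst (F.obj X) (F.map g) := by
  have h₁ : F.map ε[X] ≫ η F = ε[F.obj X] := IsMarkovFunctor.map_discard X
  have h₂ : F.map (λ_ Z).hom = δ F (𝟙_ C) Z ≫ η F ▷ F.obj Z ≫ (λ_ (F.obj Z)).hom := by
    simp
  rw [ignoreFst, ignoreFst, Functor.map_comp, Functor.map_comp, ← μ_natural_left_assoc, h₂, ← h₁]
  simp

end MarkovNotions

/-! ### Images of causal effects and the main theorem -/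

namespace CausalGraph

open MarkovNotions

variable {V : Type u} (G : CausalGraph V) [Finite V]
  {M : Type*} [Category M] [MonoidalCategory M] [MarkovCategory M] (F : Cau G ⥤ M) [F.Braided]

/-- As `F` is braided, the braiding of the images moves inside `F`, so that the identities of the
causal theory apply. -/
theorem pairEffect_eq (u v w : List V) :
    G.pairEffect F u v w = Functor.LaxMonoidal.μ F (G.obj v) (G.obj u) ≫
      F.map ((β_ (G.obj v) (G.obj u)).hom ≫
        (G.effect (u ++ v) w : G.obj u ⊗ G.obj v ⟶ G.obj w)) := by
  rw [pairEffect, Functor.map_comp, ← Category.assoc, ← Category.assoc,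
    Functor.LaxBraided.braided]

variable [IsMarkovFunctor F]

theorem BackwardTSeparated.jointEffect_eq {u v w : List V} (hu : u.Nodup) (hvw : v.Disjoint w)
    (h : G.BackwardTSeparated {x | x ∈ v} {x | x ∈ w} {x | x ∈ u}) :
    G.jointEffect F u v w = disintegrate (F.map (G.effect u v)) (G.pairEffect F u v w) := by
  rw [pairEffect_eq, ← map_disintegrate, ← BackwardTSeparated.effect_append G hu hvw h]
  rfl

theorem ForwardTSeparated.pairEffect_eq {u v w : List V} (hu : u.Nodup) (hv : v.Nodup)
    (huv : u.Disjoint v) (hvw : v.Disjoint w)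
    (h : G.ForwardTSeparated {x | x ∈ v} {x | x ∈ w} {x | x ∈ u}) :
    G.pairEffect F u v w = ignoreFst (F.obj (G.obj v)) (F.map (G.effect u w)) := by
  rw [CausalGraph.pairEffect_eq, ForwardTSeparated.braiding_effect G hu hv huv hvw h,
    map_ignoreFst]

end CausalGraph

theorem mainTheorem4 {V : Type*} [Finite V] (G : CausalGraph V)
    {M : Type*} [Category M] [MonoidalCategory M] [MarkovCategory M]
    (F : Cau G ⥤ M) [F.Braided] [MarkovNotions.IsMarkovFunctor F]
    (u v w : List V) (hu : u.Nodup) (hv : v.Nodup) (hw : w.Nodup)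
    (huv : u.Disjoint v) (huw : u.Disjoint w) (hvw : v.Disjoint w) :
    (G.TSeparated {x | x ∈ v} {x | x ∈ w} {x | x ∈ u} →
      MarkovNotions.CondIndep (G.jointEffect F u v w)) ∧
    (G.BackwardTSeparated {x | x ∈ v} {x | x ∈ w} {x | x ∈ u} →
      MarkovNotions.IsConditional (G.jointEffect F u v w) (G.pairEffect F u v w) ∧
      G.jointEffect F u v w =
        MarkovNotions.disintegrate (F.map (G.effect u v)) (G.pairEffect F u v w)) ∧
    (G.ForwardTSeparated {x | x ∈ v} {x | x ∈ w} {x | x ∈ u} →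
      MarkovNotions.CondIrrelevant (G.pairEffect F u v w) ∧
      G.pairEffect F u v w =
        MarkovNotions.ignoreFst (F.obj (G.obj v)) (F.map (G.effect u w))) := by
  refine ⟨fun h => ?_, fun h => ?_, fun h => ?_⟩
  -- Substituting the conditional that ignores `v` into the disintegration leaves a pairing, and
  -- every pairing is conditionally independent.
  · rw [CausalGraph.BackwardTSeparated.jointEffect_eq G F hu hvw h.2,
      CausalGraph.ForwardTSeparated.pairEffect_eq G F hu hv huv hvw h.1,
      MarkovNotions.disintegrate_ignoreFst]
    exact MarkovNotions.condIndep_pair _ _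
  · have e := CausalGraph.BackwardTSeparated.jointEffect_eq G F hu hvw h
    refine ⟨?_, e⟩
    rw [MarkovNotions.IsConditional, e, MarkovNotions.marginalFst_disintegrate]
  · have e := CausalGraph.ForwardTSeparated.pairEffect_eq G F hu hv huv hvw h
    exact ⟨⟨_, e⟩, e⟩
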